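/- Let $d\ge 1$, let $T\ge 1$ be an integer, and let $\mathcal L\subset\mathbb R^d$ be uniformly discrete (there is $r>0$ with $|x-y|\ge r$ for all distinct $x,y\in\mathcal L$) and $T$-periodic ($\mathcal L+Tz=\mathcal L$ for all $z\in\mathbb Z^d$). Let $c_{i,j}\ge 0$, $i,j\in\mathcal L$, satisfy (H1) $c_{i+Tz,\,j+Tz}=c_{i,j}$ for all $i,j\in\mathcal L$ and $z\in\mathbb Z^d$; (H2) $\sum_{j\in\mathcal L}c_{i,j}|i-j|<+\infty$ for all $i\in\mathcal L$. For $u\colon\mathcal L\to\mathbb R$ and $A\subset\mathbb R^d$ put $E(u,A)=\sum_{i\in\mathcal L\cap A}\sum_{j\in\mathcal L}c_{i,j}\,(u(i)-u(j))^+$. Let $Q_\rho=[-\rho/2,\rho/2)^d$. For every unit vector $\nu$ fix an orthogonal map $R^\nu$ of $\mathbb R^d$ with $R^\nu e_d=\nu$, and put $Q^\nu_\rho=R^\nu Q_\rho$; let $u_\nu(x)=1$ if $\langle\nu,x\rangle\ge 0$ and $u_\nu(x)=0$ otherwise. Then there is exactly one function $\varphi\colon\mathbb R^d\to[0,+\infty)$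 (the homogenized surface energy density) that is convex, positively homogeneous of degree one, and satisfies, for every unit vector $\nu$, $$\varphi(\nu)=\lim_{\delta\to0^+}\lim_{S\to+\infty}\frac1{S^{d-1}}\inf\Big\{E(u,Q^\nu_S)\colon u\colon\mathcal L\to\{0,1\},\ u(i)=u_\nu(i)\text{ for all } i\in\mathcal L\setminus Q^\nu_{(1-\delta)S}\Big\},$$ where the inner limit exists for every $\delta\in(0,1)$. Moreover, for every $\nu\in\mathbb R^d$, $$\varphi(\nu)=\frac1{T^d}\inf\Big\{E(u,Q_T)\colon u\colon\mathcal L\to\mathbb R,\ u(x+Tz)-\langle\nu,x+Tz\rangle=u(x)-\langle\nu,x\rangle\text{ for all }x\in\mathcal L,\ z\in\mathbb Z^d\Big\}.$$ -/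

import Mathlib

open Filter Topology
open scoped NNReal ENNReal

noncomputable section

namespace SpinHomogenization

/-- Euclidean space `ℝ^d` with `d = n + 1` (so that `d ≥ 1` and `d - 1 = n`). -/
abbrev Space (n : ℕ) : Type := EuclideanSpace ℝ (Fin (n + 1))

/-- The vector `T z`, for `z ∈ ℤ^d`. -/
def shift {n : ℕ} (T : ℕ) (z : Fin (n + 1) → ℤ) : Space n :=
  WithLp.toLp 2 (fun k => (T : ℝ) * (z k : ℝ))

/-- The last vector `e_d` of the standard basis. -/
def lastBasisVector (n : ℕ) : Space n := EuclideanSpace.single (Fin.last n) (1 : ℝ)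

/-- The half open cube `Q_ρ = [-ρ/2, ρ/2)^d`. -/
def cube (n : ℕ) (ρ : ℝ) : Set (Space n) := {x | ∀ k, -(ρ / 2) ≤ x k ∧ x k < ρ / 2}

/-- A choice, for every unit vector `ν`, of an orthogonal map `R^ν` with `R^ν e_d = ν`.
(For `d = 1` and `ν = -e_1` only the reflection is available, hence orthogonal maps of either
determinant are admitted.) -/
def IsFrameChoice {n : ℕ} (R : Space n → (Space n ≃ₗᵢ[ℝ] Space n)) : Prop :=
  ∀ ν : Space n, ‖ν‖ = 1 → R ν (lastBasisVector n) = ν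

/-- Uniform discreteness of the point set `L`. -/
def UniformlyDiscrete {n : ℕ} (L : Set (Space n)) : Prop :=
  ∃ r : ℝ, 0 < r ∧ ∀ x ∈ L, ∀ y ∈ L, x ≠ y → r ≤ dist x y

/-- `L + T z = L` for all `z ∈ ℤ^d`. -/
def PeriodicSet {n : ℕ} (T : ℕ) (L : Set (Space n)) : Prop :=
  ∀ z : Fin (n + 1) → ℤ, (fun x => x + shift T z) '' L = L

/-- `c_{i + Tz, j + Tz} = c_{i, j}` for all `i, j ∈ L`, `z ∈ ℤ^d`. -/
def PeriodicCoeff {n : ℕ} {L : Set (Space n)} (T : ℕ) (c : L → L → ℝ≥0) : Prop :=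
  ∀ (z : Fin (n + 1) → ℤ) (i j i' j' : L),
    (i' : Space n) = i + shift T z → (j' : Space n) = j + shift T z → c i' j' = c i j

/-- `∑_j c_{i, j} |i - j| < ∞` for every `i ∈ L`. -/
def DecayCoeff {n : ℕ} {L : Set (Space n)} (c : L → L → ℝ≥0) : Prop :=
  ∀ i : L, Summable (fun j : L => (c i j : ℝ) * ‖(i : Space n) - (j : Space n)‖)

/-- `E(u, A) = ∑_{i ∈ L ∩ A} ∑_{j ∈ L} c_{i, j} (u(i) - u(j))^+`, a sum of nonnegative terms with
value in `[0, ∞]`; `ENNReal.ofReal` is the positive part. -/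
def energy {n : ℕ} {L : Set (Space n)} (c : L → L → ℝ≥0) (u : L → ℝ) (A : Set (Space n)) : ℝ≥0∞ :=
  ∑' i : {i : L // (i : Space n) ∈ A}, ∑' j : L, (c i j : ℝ≥0∞) * ENNReal.ofReal (u i - u j)

/-- `u_ν(x) = 1` if `⟨ν, x⟩ ≥ 0` and `u_ν(x) = 0` otherwise. -/
def halfSpaceSpin {n : ℕ} (ν x : Space n) : ℝ := if 0 ≤ inner ℝ ν x then 1 else 0

/-- The infimum of `E(u, Q^ν_S)` over `u : L → {0, 1}` with `u = u_ν` on `L \ Q^ν_{(1-δ)S}`,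
where `Q^ν_ρ` is the image of `Q_ρ` under `Rν`. -/
def dirichletCell {n : ℕ} {L : Set (Space n)} (c : L → L → ℝ≥0)
    (Rν : Space n ≃ₗᵢ[ℝ] Space n) (ν : Space n) (δ S : ℝ) : ℝ≥0∞ :=
  ⨅ u ∈ {u : L → ℝ | (∀ i, u i = 0 ∨ u i = 1) ∧
      ∀ i : L, (i : Space n) ∉ Rν '' cube n ((1 - δ) * S) → u i = halfSpaceSpin ν i},
    energy c u (Rν '' cube n S)

/-- `φ : ℝ^d → [0, ∞)` is the homogenized surface energy density: it is convex, positively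
homogeneous of degree one, and on unit vectors it is the iterated limit
`lim_{δ → 0} lim_{S → ∞} S^{-(d-1)} inf {…}`, where `g δ` is the inner limit. -/
structure IsHomogenizedDensity {n : ℕ} {L : Set (Space n)} (c : L → L → ℝ≥0)
    (R : Space n → (Space n ≃ₗᵢ[ℝ] Space n)) (φ : Space n → ℝ≥0) : Prop where
  convex : ConvexOn ℝ Set.univ (fun ν => (φ ν : ℝ))
  homogeneous : ∀ (t : ℝ≥0) (ν : Space n), 0 < t → φ ((t : ℝ) • ν) = t * φ ν
  cell_limit : ∀ ν : Space n, ‖ν‖ = 1 → ∃ g : ℝ → ℝ≥0∞,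
    (∀ δ ∈ Set.Ioo (0 : ℝ) 1,
      Tendsto (fun S : ℝ => dirichletCell c (R ν) ν δ S / ENNReal.ofReal (S ^ n)) atTop
        (𝓝 (g δ))) ∧
    Tendsto g (𝓝[>] 0) (𝓝 (φ ν : ℝ≥0∞))

/-- The function `v` on `L` satisfies `v(x + T z) = v(x)` for all `x ∈ L`, `z ∈ ℤ^d`. -/
def PeriodicFun {n : ℕ} {L : Set (Space n)} (T : ℕ) (v : L → ℝ) : Prop :=
  ∀ (z : Fin (n + 1) → ℤ) (x y : L), (y : Space n) = x + shift T z → v y = v x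

/-- The infimum of `E(u, Q_T)` over `u : L → ℝ` such that `u - ⟨ν, ·⟩` is `T`-periodic. -/
def periodicCell {n : ℕ} {L : Set (Space n)} (T : ℕ) (c : L → L → ℝ≥0) (ν : Space n) : ℝ≥0∞ :=
  ⨅ u ∈ {u : L → ℝ | PeriodicFun T (fun i : L => u i - inner ℝ ν (i : Space n))},
    energy c u (cube n T)

end SpinHomogenization

end

/-!
For a frame `R` with `R e_d = ν`, the heights `⟨ν, T z⟩` of the lattice points in large cubes of
side `S` equidistribute: their number per unit of cross section in a window of heights `[a, b)`
tends to `G b - G a` for a monotone function `G`, which is affine up to a bounded error. A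
function `u` with `u - ⟨ν, ·⟩` periodic has level sets `{u ≥ t}` whose surface energy density is
therefore computed from `G`, and by the coarea formula its average over `t` is the energy of `u`
on a period cell. So some level set is as good as the best `u`; gluing it to the half space
outside of the cube costs only a lower order energy. Conversely the sum of all lattice translates
of `u - u_ν`, for a competitor `u` of the problem in a cube, is periodic after adding a function
of the height, and subadditivity bounds its cell energy by that of `u`.

The cube boundary condition leaves a layer where the interface is flat, so that for fixed `δ` the
inner limit is `(1 - δ)^{d-1}` times the cell formula plus `1 - (1 - δ)^{d-1}` times the energy
density of the flat interface, and only the first part survives as `δ → 0`.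
-/

noncomputable section

namespace SpinHomogenization

open MeasureTheory

/-! ### Lattice points in slabs -/

section

variable {n T : ℕ} {R : Space n ≃ₗᵢ[ℝ] Space n} {S S' a b : ℝ} {x y : Space n}

/-- The index set `ℤ^d` of the period lattice `T ℤ^d`. -/
abbrev LatticeIndex (n : ℕ) : Type := Fin (n + 1) → ℤ

theorem shift_apply (T : ℕ) (z : LatticeIndex n) (k : Fin (n + 1)) :
    shift T z k = (T : ℝ) * (z k : ℝ) := rfl

theorem shift_add (T : ℕ) (z w : LatticeIndex n) : shift T (z + w) = shift T z + shift T w := by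
  ext k; simp [shift_apply, mul_add]

theorem shift_neg (T : ℕ) (z : LatticeIndex n) : shift T (-z) = -shift T z := by
  ext k; simp [shift_apply]

theorem shift_zero (T : ℕ) : shift T (0 : LatticeIndex n) = 0 := by
  ext k; simp [shift_apply]

theorem shift_nsmul (T k : ℕ) (z : LatticeIndex n) :
    shift T (k • z) = (k : ℝ) • shift T z := by
  ext i; simp [shift_apply]; ring

/-- The coordinate along the axis `R e_d`. -/
def height (R : Space n ≃ₗᵢ[ℝ] Space n) : Space n →L[ℝ] ℝ :=
  (EuclideanSpace.proj (Fin.last n)).comp (R.symm : Space n →L[ℝ] Space n)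

theorem height_apply (R : Space n ≃ₗᵢ[ℝ] Space n) (x : Space n) :
    height R x = R.symm x (Fin.last n) := rfl

theorem abs_symm_apply_le (R : Space n ≃ₗᵢ[ℝ] Space n) (x : Space n) (k : Fin (n + 1)) :
    |R.symm x k| ≤ ‖x‖ := by
  simpa using PiLp.norm_apply_le (R.symm x) k

theorem abs_height_le (R : Space n ≃ₗᵢ[ℝ] Space n) (x : Space n) : |height R x| ≤ ‖x‖ :=
  abs_symm_apply_le R x _

theorem inner_eq_height {ν : Space n} (hR : R (lastBasisVector n) = ν) (x : Space n) :
    inner ℝ ν x = height R x := by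
  rw [← hR, ← R.apply_symm_apply x, R.inner_map_map]
  simp [lastBasisVector, height_apply, EuclideanSpace.inner_single_left]

/-- The infinite cylinder with axis `R e_d` over a cube of side `S` in dimension `d - 1`. -/
def cylinder (R : Space n ≃ₗᵢ[ℝ] Space n) (S : ℝ) : Set (Space n) :=
  {x | ∀ k : Fin n, -(S / 2) ≤ R.symm x k.castSucc ∧ R.symm x k.castSucc < S / 2}

/-- The part of `cylinder R S` at heights in `[a, b)`. -/
def slabBox (R : Space n ≃ₗᵢ[ℝ] Space n) (S a b : ℝ) : Set (Space n) :=
  {x | x ∈ cylinder R S ∧ a ≤ height R x ∧ height R x < b}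

theorem image_cube (R : Space n ≃ₗᵢ[ℝ] Space n) (S : ℝ) :
    R '' cube n S = slabBox R S (-(S / 2)) (S / 2) := by
  ext x
  rw [R.image_eq_preimage_symm]
  exact Fin.forall_fin_succ'

theorem cube_eq_slabBox (n : ℕ) (S : ℝ) :
    cube n S = slabBox (LinearIsometryEquiv.refl ℝ (Space n)) S (-(S / 2)) (S / 2) := by
  simp [← image_cube]

theorem mem_cylinder_of_norm_sub_le {m : ℝ} (hx : x ∈ cylinder R S) (hxy : ‖x - y‖ ≤ m)
    (h : S + 2 * m ≤ S') : y ∈ cylinder R S' := by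
  intro k
  have hk := abs_le.1 ((abs_symm_apply_le R (x - y) k.castSucc).trans hxy)
  simp only [map_sub, PiLp.sub_apply] at hk
  constructor <;> linarith [(hx k).1, (hx k).2, hk.1, hk.2]

theorem mem_slabBox_of_norm_sub_le {a' b' m : ℝ} (hx : x ∈ slabBox R S a b) (hxy : ‖x - y‖ ≤ m)
    (h : S + 2 * m ≤ S') (ha : a' ≤ a - m) (hb : b + m ≤ b') : y ∈ slabBox R S' a' b' := by
  have hh := abs_le.1 ((abs_height_le R (x - y)).trans hxy)
  rw [map_sub] at hh
  refine ⟨mem_cylinder_of_norm_sub_le hx.1 hxy h, ?_, ?_⟩ <;> linarith [hx.2.1, hx.2.2]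

theorem slabBox_eq_preimage_pi (R : Space n ≃ₗᵢ[ℝ] Space n) (S a b : ℝ) :
    slabBox R S a b = (fun x => WithLp.ofLp (R.symm x)) ⁻¹' Set.univ.pi fun k : Fin (n + 1) =>
      Set.Ico ((Fin.snoc (fun _ => -(S / 2)) a : Fin (n + 1) → ℝ) k)
        ((Fin.snoc (fun _ => S / 2) b : Fin (n + 1) → ℝ) k) := by
  ext x
  simp [slabBox, cylinder, height_apply, Fin.forall_fin_succ']

theorem measurePreserving_ofLp_symm (R : Space n ≃ₗᵢ[ℝ] Space n) :
    MeasurePreserving (fun x => WithLp.ofLp (R.symm x)) :=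
  (PiLp.volume_preserving_ofLp _).comp R.symm.measurePreserving

theorem measurableSet_slabBox (R : Space n ≃ₗᵢ[ℝ] Space n) (S a b : ℝ) :
    MeasurableSet (slabBox R S a b) := by
  rw [slabBox_eq_preimage_pi]
  exact (measurePreserving_ofLp_symm R).measurable
    (MeasurableSet.univ_pi fun _ => measurableSet_Ico)

theorem volume_slabBox (R : Space n ≃ₗᵢ[ℝ] Space n) (hS : 0 ≤ S) (a b : ℝ) :
    volume (slabBox R S a b) = ENNReal.ofReal (S ^ n * (b - a)) := by
  rw [slabBox_eq_preimage_pi, (measurePreserving_ofLp_symm R).measure_preimage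
    (MeasurableSet.univ_pi fun _ => measurableSet_Ico).nullMeasurableSet, Real.volume_pi_Ico,
    Fin.prod_univ_castSucc]
  simp [ENNReal.ofReal_mul, ENNReal.ofReal_pow, hS]

theorem volume_slabBox_diff (R : Space n ≃ₗᵢ[ℝ] Space n) (hS' : 0 ≤ S') (h : S' ≤ S) (a b : ℝ) :
    volume (slabBox R S a b \ slabBox R S' a b) =
      ENNReal.ofReal ((S ^ n - S' ^ n) * (b - a)) := by
  have hsub : slabBox R S' a b ⊆ slabBox R S a b := fun y hy =>
    ⟨mem_cylinder_of_norm_sub_le (m := 0) (x := y) hy.1 (by simp) (by linarith), hy.2⟩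
  have hpow : S' ^ n ≤ S ^ n := pow_le_pow_left₀ hS' h n
  rw [measure_sdiff hsub (measurableSet_slabBox R S' a b).nullMeasurableSet
    (by simp [volume_slabBox R hS']), volume_slabBox R (hS'.trans h), volume_slabBox R hS',
    ENNReal.ofReal_mul (pow_nonneg (hS'.trans h) n), ENNReal.ofReal_mul (by positivity),
    ENNReal.ofReal_mul (sub_nonneg.2 hpow), ← ENNReal.sub_mul fun _ _ => ENNReal.ofReal_ne_top,
    ENNReal.ofReal_sub (S ^ n) (by positivity)]

theorem measurableSet_cube (n : ℕ) (S : ℝ) : MeasurableSet (cube n S) := by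
  rw [cube_eq_slabBox]; exact measurableSet_slabBox _ _ _ _

theorem volume_cube (n T : ℕ) : volume (cube n T) = ENNReal.ofReal ((T : ℝ) ^ (n + 1)) := by
  rw [cube_eq_slabBox, volume_slabBox _ T.cast_nonneg]
  congr 1; ring

theorem exists_sub_shift_mem_cube (hT : 0 < T) (x : Space n) :
    ∃ z : LatticeIndex n, x - shift T z ∈ cube n T := by
  have hT' : (0 : ℝ) < T := by exact_mod_cast hT
  refine ⟨fun k => ⌊x k / T + 1 / 2⌋, fun k => ?_⟩
  have hle := Int.floor_le (x k / T + 1 / 2)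
  have hlt := Int.lt_floor_add_one (x k / T + 1 / 2)
  have hxk : x k = T * (x k / T) := by field_simp
  simp only [PiLp.sub_apply, shift_apply]
  constructor <;> nlinarith

theorem eq_of_sub_shift_mem_cube {z w : LatticeIndex n}
    (hz : x - shift T z ∈ cube n T) (hw : x - shift T w ∈ cube n T) : z = w := by
  funext k
  have hzk := hz k
  have hwk := hw k
  simp only [PiLp.sub_apply, shift_apply] at hzk hwk
  have hT' : (0 : ℝ) < T := by linarith
  have hlt : |((z k - w k : ℤ) : ℝ)| < 1 := by
    rw [← mul_lt_mul_iff_right₀ hT', ← abs_of_pos hT', ← abs_mul, abs_of_pos hT', abs_lt]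
    push_cast
    constructor <;> linarith
  have : |z k - w k| < 1 := by exact_mod_cast hlt
  grind

/-- A bound for the distance of the points of a lattice cell to its centre. -/
def cellRadius (n T : ℕ) : ℝ := √(n + 1) * T

theorem cellRadius_nonneg (n T : ℕ) : 0 ≤ cellRadius n T := by unfold cellRadius; positivity

theorem norm_le_cellRadius (hx : x ∈ cube n T) : ‖x‖ ≤ cellRadius n T := by
  refine abs_le_of_sq_le_sq' ?_ (cellRadius_nonneg n T) |>.2
  rw [cellRadius, EuclideanSpace.norm_sq_eq, mul_pow, Real.sq_sqrt (by positivity)]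
  calc ∑ k, ‖x k‖ ^ 2 ≤ ∑ _k : Fin (n + 1), (T : ℝ) ^ 2 := by
        refine Finset.sum_le_sum fun k _ => ?_
        rw [Real.norm_eq_abs]
        have : (0 : ℝ) ≤ T := T.cast_nonneg
        exact pow_le_pow_left₀ (abs_nonneg _) (abs_le.2 ⟨by linarith [(hx k).1],
          by linarith [(hx k).2]⟩) 2
    _ = (n + 1) * (T : ℝ) ^ 2 := by simp

/-- The translate of the period cell `Q_T` centred at the lattice point `T z`. -/
def latticeCell (n T : ℕ) (z : LatticeIndex n) : Set (Space n) := {x | x - shift T z ∈ cube n T}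

theorem volume_latticeCell (n T : ℕ) (z : LatticeIndex n) :
    volume (latticeCell n T z) = ENNReal.ofReal ((T : ℝ) ^ (n + 1)) := by
  rw [← volume_cube]
  have : latticeCell n T z = (fun x => x + (-shift T z)) ⁻¹' cube n T := by
    ext x; simp [latticeCell, sub_eq_add_neg]
  rw [this, measure_preimage_add_right]

theorem measurableSet_latticeCell (n T : ℕ) (z : LatticeIndex n) :
    MeasurableSet (latticeCell n T z) :=
  (measurable_id.sub_const (shift T z)) (measurableSet_cube n T)

theorem volume_iUnion_latticeCell (T : ℕ) (A : Set (LatticeIndex n)) :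
    volume (⋃ z ∈ A, latticeCell n T z) =
      Measure.count A * ENNReal.ofReal ((T : ℝ) ^ (n + 1)) := by
  have hdisj : A.PairwiseDisjoint (latticeCell n T) := fun z _ w _ hzw =>
    Set.disjoint_left.2 fun x hx hy => hzw (eq_of_sub_shift_mem_cube hx hy)
  rw [measure_biUnion A.to_countable hdisj fun z _ => measurableSet_latticeCell n T z]
  simp only [volume_latticeCell]
  rw [ENNReal.tsum_const, Measure.count_apply A.to_countable.measurableSet]
  rfl

theorem count_le_ofReal_div_of_volume_le (hT : 0 < T) {A : Set (LatticeIndex n)} {B : Set (Space n)}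
    {V : ℝ} (x : Space n) (hV : volume B ≤ ENNReal.ofReal V)
    (h : ∀ z ∈ A, ∀ y, ‖x + shift T z - y‖ ≤ cellRadius n T → y ∈ B) :
    Measure.count A ≤ ENNReal.ofReal (V / (T : ℝ) ^ (n + 1)) := by
  have : (0 : ℝ) < T := by exact_mod_cast hT
  rw [ENNReal.ofReal_div_of_pos (by positivity), ENNReal.le_div_iff_mul_le
    (Or.inl (ENNReal.ofReal_pos.2 (by positivity)).ne') (Or.inl ENNReal.ofReal_ne_top),
    ← volume_iUnion_latticeCell]
  refine le_trans ?_ hV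
  rw [← measure_preimage_add volume x B]
  refine measure_mono (Set.iUnion₂_subset fun z hz y hy => h z hz _ ?_)
  rw [add_sub_add_left_eq_sub, norm_sub_rev]
  exact norm_le_cellRadius hy

theorem ofReal_div_le_count_of_le_volume (hT : 0 < T) {A : Set (LatticeIndex n)} {B : Set (Space n)}
    {V : ℝ} (x : Space n) (hV : ENNReal.ofReal V ≤ volume B)
    (h : ∀ y ∈ B, ∀ z, ‖y - (x + shift T z)‖ ≤ cellRadius n T → z ∈ A) :
    ENNReal.ofReal (V / (T : ℝ) ^ (n + 1)) ≤ Measure.count A := by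
  have : (0 : ℝ) < T := by exact_mod_cast hT
  rw [ENNReal.ofReal_div_of_pos (by positivity)]
  refine ENNReal.div_le_of_le_mul ?_
  rw [← volume_iUnion_latticeCell]
  refine hV.trans ?_
  rw [← measure_preimage_add volume x B]
  refine measure_mono fun y hy => ?_
  obtain ⟨z, hz⟩ := exists_sub_shift_mem_cube hT y
  refine Set.mem_iUnion₂.2 ⟨z, h _ hy z ?_, hz⟩
  rw [add_sub_add_left_eq_sub]
  exact norm_le_cellRadius hz

/-- The indices `z` with `x + T z` in `cylinder R S` and `T z` at height in `[a, b)`. -/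
def slabSet (R : Space n ≃ₗᵢ[ℝ] Space n) (T : ℕ) (S : ℝ) (x : Space n) (a b : ℝ) :
    Set (LatticeIndex n) :=
  {z | x + shift T z ∈ cylinder R S ∧ a ≤ height R (shift T z) ∧ height R (shift T z) < b}

theorem mem_slabSet_iff {z : LatticeIndex n} : z ∈ slabSet R T S x a b ↔
    x + shift T z ∈ slabBox R S (height R x + a) (height R x + b) := by
  simp only [slabSet, slabBox, Set.mem_ofPred_eq, map_add, add_le_add_iff_left,
    add_lt_add_iff_left]

theorem count_slabSet_le (hT : 0 < T) (R : Space n ≃ₗᵢ[ℝ] Space n) (hS : 0 ≤ S) (x : Space n)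
    (a b : ℝ) : Measure.count (slabSet R T S x a b) ≤ ENNReal.ofReal
      ((S + 2 * cellRadius n T) ^ n * (b - a + 2 * cellRadius n T) / (T : ℝ) ^ (n + 1)) := by
  have hD := cellRadius_nonneg n T
  refine count_le_ofReal_div_of_volume_le hT x ?_ fun z hz y hy =>
    mem_slabBox_of_norm_sub_le (mem_slabSet_iff.1 hz) hy le_rfl le_rfl le_rfl
  rw [volume_slabBox R (by positivity)]
  exact (congrArg ENNReal.ofReal (by ring)).le

theorem le_count_slabSet (hT : 0 < T) (R : Space n ≃ₗᵢ[ℝ] Space n) (hS : 2 * cellRadius n T ≤ S)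
    (x : Space n) (a b : ℝ) : ENNReal.ofReal
      ((S - 2 * cellRadius n T) ^ n * (b - a - 2 * cellRadius n T) / (T : ℝ) ^ (n + 1)) ≤
      Measure.count (slabSet R T S x a b) := by
  have hvol := volume_slabBox R (sub_nonneg.2 hS) (height R x + a + cellRadius n T)
    (height R x + b - cellRadius n T)
  refine ofReal_div_le_count_of_le_volume hT x (hvol.trans (congrArg _ (by ring))).ge
    fun y hy z hz => mem_slabSet_iff.2 (mem_slabBox_of_norm_sub_le hy hz ?_ ?_ ?_) <;> linarith

theorem count_slabSet_ne_top (hT : 0 < T) (R : Space n ≃ₗᵢ[ℝ] Space n) (hS : 0 ≤ S)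
    (x : Space n) (a b : ℝ) : Measure.count (slabSet R T S x a b) ≠ ⊤ :=
  ((count_slabSet_le hT R hS x a b).trans_lt ENNReal.ofReal_lt_top).ne

theorem exists_count_slabSet_le (n : ℕ) (hT : 0 < T) :
    ∃ C : ℝ, 0 < C ∧ ∀ (R : Space n ≃ₗᵢ[ℝ] Space n) (S a b : ℝ) (x : Space n), 1 ≤ S →
      Measure.count (slabSet R T S x a b) ≤ ENNReal.ofReal (C * (1 + |b - a|) * S ^ n) := by
  have : (0 : ℝ) < T := by exact_mod_cast hT
  set D := cellRadius n T
  have hD : 0 ≤ D := cellRadius_nonneg n T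
  refine ⟨(1 + 2 * D) ^ n * (1 + 2 * D) / (T : ℝ) ^ (n + 1), by positivity,
    fun R S a b x hS => (count_slabSet_le hT R (by linarith) x a b).trans
      (ENNReal.ofReal_le_ofReal ?_)⟩
  have hbase : S + 2 * D ≤ (1 + 2 * D) * S := by nlinarith
  have hheight : b - a + 2 * D ≤ (1 + 2 * D) * (1 + |b - a|) := by
    nlinarith [le_abs_self (b - a), abs_nonneg (b - a)]
  calc (S + 2 * D) ^ n * (b - a + 2 * D) / (T : ℝ) ^ (n + 1)
      ≤ (S + 2 * D) ^ n * ((1 + 2 * D) * (1 + |b - a|)) / (T : ℝ) ^ (n + 1) := by gcongr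
    _ ≤ ((1 + 2 * D) * S) ^ n * ((1 + 2 * D) * (1 + |b - a|)) / (T : ℝ) ^ (n + 1) := by gcongr
    _ = _ := by rw [mul_pow]; ring

theorem count_slabSet_diff_le (hT : 0 < T) (R : Space n ≃ₗᵢ[ℝ] Space n) (x y : Space n) (a b : ℝ)
    (hS : 2 * ‖x - y‖ + 2 * cellRadius n T ≤ S) :
    Measure.count {z ∈ slabSet R T S x a b | y + shift T z ∉ cylinder R S} ≤ ENNReal.ofReal
      (((S + 2 * cellRadius n T) ^ n - (S - (2 * ‖x - y‖ + 2 * cellRadius n T)) ^ n) *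
        (b - a + 2 * cellRadius n T) / (T : ℝ) ^ (n + 1)) := by
  have hD := cellRadius_nonneg n T
  have hm := norm_nonneg (x - y)
  have hvol := volume_slabBox_diff R (sub_nonneg.2 hS)
    (by linarith : _ ≤ S + 2 * cellRadius n T) (height R x + a - cellRadius n T)
    (height R x + b + cellRadius n T)
  refine count_le_ofReal_div_of_volume_le hT x (hvol.trans (congrArg _ (by ring))).le ?_
  rintro z ⟨hz, hzy⟩ p hp
  refine ⟨mem_slabBox_of_norm_sub_le (mem_slabSet_iff.1 hz) hp le_rfl le_rfl le_rfl,
    fun hp' => hzy ?_⟩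
  refine mem_cylinder_of_norm_sub_le (m := ‖x - y‖ + cellRadius n T) hp'.1 ?_ (by linarith)
  calc ‖p - (y + shift T z)‖ = ‖(x - y) - (x + shift T z - p)‖ := by congr 1; abel
    _ ≤ ‖x - y‖ + cellRadius n T := (norm_sub_le _ _).trans (by gcongr)

end

/-! ### Equidistribution of heights -/

section

variable {n T : ℕ} {R : Space n ≃ₗᵢ[ℝ] Space n} {b d : ℝ} {x : Space n}
  {f g : ℝ → ℝ≥0∞} {l m : ℝ≥0∞} {G : ℝ → ℝ}

/-- `f S` grows like `l S^{d-1}` as `S → ∞`, where `d - 1 = n`. -/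
def HasSurfaceDensity (n : ℕ) (f : ℝ → ℝ≥0∞) (l : ℝ≥0∞) : Prop :=
  Tendsto (fun S => f S / ENNReal.ofReal (S ^ n)) atTop (𝓝 l)

theorem HasSurfaceDensity.add (hf : HasSurfaceDensity n f l) (hg : HasSurfaceDensity n g m) :
    HasSurfaceDensity n (fun S => f S + g S) (l + m) := by
  unfold HasSurfaceDensity at *
  simpa only [ENNReal.add_div] using Tendsto.add hf hg

theorem HasSurfaceDensity.congr' (hf : HasSurfaceDensity n f l) (h : f =ᶠ[atTop] g) :
    HasSurfaceDensity n g l := by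
  refine Tendsto.congr' ?_ hf
  filter_upwards [h] with S hS
  rw [hS]

theorem HasSurfaceDensity.mono_zero (hg : HasSurfaceDensity n g 0) (h : ∀ᶠ S in atTop, f S ≤ g S) :
    HasSurfaceDensity n f 0 := by
  refine tendsto_of_tendsto_of_tendsto_of_le_of_le' tendsto_const_nhds hg
    (Eventually.of_forall fun _ => zero_le) ?_
  filter_upwards [h] with S hS
  gcongr

theorem hasSurfaceDensity_zero_of_eventually (h : ∀ᶠ S in atTop, f S = 0) :
    HasSurfaceDensity n f 0 := by
  refine tendsto_const_nhds.congr' ?_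
  filter_upwards [h] with S hS
  rw [hS, ENNReal.zero_div]

theorem hasSurfaceDensity_ofReal {f : ℝ → ℝ} {l : ℝ}
    (h : Tendsto (fun S => f S / S ^ n) atTop (𝓝 l)) :
    HasSurfaceDensity n (fun S => ENNReal.ofReal (f S)) (ENNReal.ofReal l) := by
  refine (ENNReal.tendsto_ofReal h).congr' ?_
  filter_upwards [eventually_gt_atTop 0] with S hS
  exact ENNReal.ofReal_div_of_pos (by positivity)

theorem HasSurfaceDensity.comp_mul_left (h : HasSurfaceDensity n f l) {θ : ℝ} (hθ : 0 < θ) :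
    HasSurfaceDensity n (fun S => f (θ * S)) (ENNReal.ofReal (θ ^ n) * l) := by
  refine (ENNReal.Tendsto.const_mul (h.comp (tendsto_id.const_mul_atTop hθ))
    (Or.inr ENNReal.ofReal_ne_top)).congr fun S => ?_
  have hθn : ENNReal.ofReal (θ ^ n) ≠ 0 := (ENNReal.ofReal_pos.2 (pow_pos hθ n)).ne'
  simp only [Function.comp, id]
  rw [mul_pow, ENNReal.ofReal_mul (by positivity), ← mul_div_assoc,
    ENNReal.mul_div_mul_left _ _ hθn ENNReal.ofReal_ne_top]

theorem tendsto_add_pow_div_pow (n : ℕ) (α : ℝ) :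
    Tendsto (fun S : ℝ => (S + α) ^ n / S ^ n) atTop (𝓝 1) := by
  have hbase : Tendsto (fun S : ℝ => 1 + α / S) atTop (𝓝 1) := by
    simpa using tendsto_const_nhds.add ((tendsto_const_nhds (x := α)).div_atTop tendsto_id)
  rw [← one_pow n]
  refine (hbase.pow n).congr' ?_
  filter_upwards [eventually_gt_atTop 0] with S hS
  rw [← div_pow, add_div, div_self hS.ne']

theorem hasSurfaceDensity_count_slabSet_diff (hT : 0 < T) (R : Space n ≃ₗᵢ[ℝ] Space n)
    (x y : Space n) (a b : ℝ) : HasSurfaceDensity n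
      (fun S => Measure.count {z ∈ slabSet R T S x a b | y + shift T z ∉ cylinder R S}) 0 := by
  set m := 2 * ‖x - y‖ + 2 * cellRadius n T
  set w := (b - a + 2 * cellRadius n T) / (T : ℝ) ^ (n + 1)
  have hlim : Tendsto (fun S : ℝ => ((S + 2 * cellRadius n T) ^ n - (S + -m) ^ n) * w / S ^ n)
      atTop (𝓝 0) := by
    have := ((tendsto_add_pow_div_pow n (2 * cellRadius n T)).sub
      (tendsto_add_pow_div_pow n (-m))).mul_const w
    rw [sub_self, zero_mul] at this
    exact this.congr fun S => by ring
  have hbound := hasSurfaceDensity_ofReal hlim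
  rw [ENNReal.ofReal_zero] at hbound
  refine hbound.mono_zero ?_
  filter_upwards [eventually_ge_atTop m] with S hS
  exact (count_slabSet_diff_le hT R x y a b hS).trans_eq (by
    rw [← sub_eq_add_neg, mul_div_assoc])

theorem slabSet_eq_empty (h : b ≤ a) : slabSet R T S x a b = ∅ :=
  Set.eq_empty_of_forall_notMem fun _ hz => (hz.2.1.trans_lt hz.2.2).not_ge h

theorem count_real_slabSet_add (hT : 0 < T) (R : Space n ≃ₗᵢ[ℝ] Space n) (hS : 0 ≤ S)
    (x : Space n) (hab : a ≤ b) (hbd : b ≤ d) :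
    Measure.count.real (slabSet R T S x a b) + Measure.count.real (slabSet R T S x b d) =
      Measure.count.real (slabSet R T S x a d) := by
  have hunion : slabSet R T S x a b ∪ slabSet R T S x b d = slabSet R T S x a d := by
    ext z
    simp only [slabSet, Set.mem_ofPred_eq, Set.mem_union]
    grind
  have hdisj : Disjoint (slabSet R T S x a b) (slabSet R T S x b d) :=
    Set.disjoint_left.2 fun z hz hz' => absurd hz.2.2 (not_lt.2 hz'.2.1)
  rw [← hunion, measureReal_union hdisj (Set.to_countable _).measurableSet
    (count_slabSet_ne_top hT R hS x a b) (count_slabSet_ne_top hT R hS x b d)]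

theorem count_slabSet_translate (R : Space n ≃ₗᵢ[ℝ] Space n) (T : ℕ) (x : Space n) (a b S : ℝ)
    (e : LatticeIndex n) :
    Measure.count (slabSet R T S x (height R (shift T e) + a) (height R (shift T e) + b)) =
      Measure.count (slabSet R T S (x + shift T e) a b) := by
  have : slabSet R T S (x + shift T e) a b =
      (e + ·) ⁻¹' slabSet R T S x (height R (shift T e) + a) (height R (shift T e) + b) := by
    ext z
    simp only [slabSet, Set.mem_preimage, Set.mem_ofPred_eq, shift_add, map_add, add_assoc,
      add_le_add_iff_left, add_lt_add_iff_left]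
  rw [← Measure.count_injective_image (add_right_injective e) (slabSet R T S (x + shift T e) a b),
    this, Set.image_preimage_eq _ (add_left_surjective e)]

/-- The number of `z` with `x + T z` in `cylinder R S` and `T z` at height in `[a, b)`, per unit of
cross section. It is counted negatively for `b < a`, so that it is additive in `[a, b)` without any
ordering condition. -/
def slabDensity (R : Space n ≃ₗᵢ[ℝ] Space n) (T : ℕ) (x : Space n) (a b S : ℝ) : ℝ :=
  (Measure.count.real (slabSet R T S x a b) - Measure.count.real (slabSet R T S x b a)) / S ^ n

theorem slabDensity_swap : slabDensity R T x b a S = -slabDensity R T x a b S := by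
  simp only [slabDensity, ← neg_div, neg_sub]

theorem slabDensity_of_le (h : a ≤ b) :
    slabDensity R T x a b S = Measure.count.real (slabSet R T S x a b) / S ^ n := by
  simp [slabDensity, slabSet_eq_empty h]

theorem slabDensity_self : slabDensity R T x a a S = 0 := by
  simp [slabDensity]

theorem slabDensity_nonneg (hS : 0 ≤ S) (h : a ≤ b) : 0 ≤ slabDensity R T x a b S := by
  rw [slabDensity_of_le h]; positivity

theorem ofReal_slabDensity (hT : 0 < T) (R : Space n ≃ₗᵢ[ℝ] Space n) (hS : 0 < S) (x : Space n)
    (a b : ℝ) : ENNReal.ofReal (slabDensity R T x a b S) =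
      Measure.count (slabSet R T S x a b) / ENNReal.ofReal (S ^ n) := by
  rcases le_total a b with h | h
  · rw [slabDensity_of_le h, ENNReal.ofReal_div_of_pos (by positivity),
      ofReal_measureReal (count_slabSet_ne_top hT R hS.le x a b)]
  · rw [slabDensity_swap, slabSet_eq_empty h,
      ENNReal.ofReal_of_nonpos (neg_nonpos.2 (slabDensity_nonneg hS.le h)), measure_empty,
      ENNReal.zero_div]

theorem slabDensity_add (hT : 0 < T) (R : Space n ≃ₗᵢ[ℝ] Space n) (hS : 0 ≤ S) (x : Space n)
    (a b d : ℝ) :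
    slabDensity R T x a b S + slabDensity R T x b d S = slabDensity R T x a d S := by
  have key : ∀ {p q r : ℝ}, p ≤ q → q ≤ r →
      slabDensity R T x p q S + slabDensity R T x q r S = slabDensity R T x p r S := by
    intro p q r hpq hqr
    rw [slabDensity_of_le hpq, slabDensity_of_le hqr, slabDensity_of_le (hpq.trans hqr),
      ← add_div, count_real_slabSet_add hT R hS x hpq hqr]
  have hab := slabDensity_swap (R := R) (T := T) (x := x) (S := S) (a := a) (b := b)
  have hbd := slabDensity_swap (R := R) (T := T) (x := x) (S := S) (a := b) (b := d)
  have had := slabDensity_swap (R := R) (T := T) (x := x) (S := S) (a := a) (b := d)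
  rcases le_total a b with h | h <;> rcases le_total b d with h' | h' <;>
    rcases le_total a d with h'' | h'' <;> grind

theorem slabDensity_mono (hT : 0 < T) (R : Space n ≃ₗᵢ[ℝ] Space n) (hS : 0 ≤ S) (x : Space n)
    (a : ℝ) : Monotone fun b => slabDensity R T x a b S := fun b d h => by
  have := slabDensity_nonneg (R := R) (T := T) (x := x) hS h
  linarith [slabDensity_add hT R hS x a b d]

theorem slabDensity_translate (R : Space n ≃ₗᵢ[ℝ] Space n) (T : ℕ) (x : Space n) (a b S : ℝ)
    (e : LatticeIndex n) :
    slabDensity R T x (height R (shift T e) + a) (height R (shift T e) + b) S =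
      slabDensity R T (x + shift T e) a b S := by
  simp only [slabDensity, measureReal_def, count_slabSet_translate]

theorem slabDensity_congr_right {b' : ℝ}
    (h : ∀ z : LatticeIndex n, height R (shift T z) < b ↔ height R (shift T z) < b') :
    slabDensity R T x a b S = slabDensity R T x a b' S := by
  have h' : ∀ z : LatticeIndex n, b ≤ height R (shift T z) ↔ b' ≤ height R (shift T z) :=
    fun z => by rw [← not_lt, h, not_lt]
  simp only [slabDensity, slabSet, h, h']

theorem tendsto_slabDensity_sub (hT : 0 < T) (R : Space n ≃ₗᵢ[ℝ] Space n) (x y : Space n)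
    (a b : ℝ) :
    Tendsto (fun S => slabDensity R T x a b S - slabDensity R T y a b S) atTop (𝓝 0) := by
  have hlim : ∀ x y a b, Tendsto (fun S : ℝ => Measure.count.real
      {z ∈ slabSet R T S x a b | y + shift T z ∉ cylinder R S} / S ^ n) atTop (𝓝 0) := by
    intro x y a b
    refine ((ENNReal.tendsto_toReal ENNReal.zero_ne_top).comp
      (hasSurfaceDensity_count_slabSet_diff hT R x y a b)).congr' ?_
    filter_upwards [eventually_gt_atTop 0] with S hS
    simp [measureReal_def, hS.le]
  have hle : ∀ x y a b, ∀ S ≥ (0 : ℝ), Measure.count.real (slabSet R T S x a b) ≤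
      Measure.count.real (slabSet R T S y a b) + Measure.count.real
        {z ∈ slabSet R T S x a b | y + shift T z ∉ cylinder R S} := by
    intro x y a b S hS
    have hfin := count_slabSet_ne_top hT R hS x a b
    refine (measureReal_mono ?_ (measure_union_ne_top (count_slabSet_ne_top hT R hS y a b)
      (measure_ne_top_of_subset (Set.sep_subset _ _) hfin))).trans (measureReal_union_le _ _)
    intro z hz
    by_cases h : y + shift T z ∈ cylinder R S
    exacts [Or.inl ⟨h, hz.2⟩, Or.inr ⟨hz, h⟩]
  have hupper := (hlim x y a b).add (hlim y x b a)
  have hlower := ((hlim y x a b).add (hlim x y b a)).neg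
  simp only [add_zero, neg_zero] at hupper hlower
  refine tendsto_of_tendsto_of_tendsto_of_le_of_le' hlower hupper ?_ ?_ <;>
    filter_upwards [eventually_gt_atTop 0] with S hS
  · rw [slabDensity, slabDensity, ← sub_div, ← add_div, ← neg_div]
    gcongr
    linarith [hle y x a b S hS.le, hle x y b a S hS.le]
  · rw [slabDensity, slabDensity, ← sub_div, ← add_div]
    gcongr
    linarith [hle x y a b S hS.le, hle y x b a S hS.le]

theorem eventually_abs_slabDensity_sub_le_of_le (hT : 0 < T) (R : Space n ≃ₗᵢ[ℝ] Space n)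
    (x : Space n) (hab : a ≤ b) : ∀ᶠ S : ℝ in atTop,
      |slabDensity R T x a b S - (b - a) / (T : ℝ) ^ (n + 1)| ≤
        2 * cellRadius n T / (T : ℝ) ^ (n + 1) + 1 := by
  have hT' : (0 : ℝ) < (T : ℝ) ^ (n + 1) := pow_pos (by exact_mod_cast hT) _
  set D := cellRadius n T
  have hD : 0 ≤ D := cellRadius_nonneg n T
  have hupper : Tendsto (fun S : ℝ => (S + 2 * D) ^ n / S ^ n * ((b - a + 2 * D) / T ^ (n + 1)))
      atTop (𝓝 ((b - a + 2 * D) / T ^ (n + 1))) := by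
    simpa using (tendsto_add_pow_div_pow n (2 * D)).mul_const ((b - a + 2 * D) / (T : ℝ) ^ (n + 1))
  have hlower : Tendsto (fun S : ℝ => (S + -(2 * D)) ^ n / S ^ n *
      ((b - a - 2 * D) / T ^ (n + 1))) atTop (𝓝 ((b - a - 2 * D) / T ^ (n + 1))) := by
    simpa using (tendsto_add_pow_div_pow n (-(2 * D))).mul_const
      ((b - a - 2 * D) / (T : ℝ) ^ (n + 1))
  filter_upwards [eventually_gt_atTop 0, eventually_ge_atTop (2 * D),
    hupper.eventually_lt_const (lt_add_one _), hlower.eventually_const_lt (sub_one_lt _)]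
    with S h0 hS hu hl
  have hcount_le := ENNReal.toReal_le_of_le_ofReal
    (div_nonneg (mul_nonneg (by positivity) (by linarith)) hT'.le)
    (count_slabSet_le hT R h0.le x a b)
  have hle_count := (ENNReal.ofReal_le_iff_le_toReal (count_slabSet_ne_top hT R h0.le x a b)).1
    (le_count_slabSet hT R hS x a b)
  have hdensity_le : slabDensity R T x a b S ≤
      (S + 2 * D) ^ n / S ^ n * ((b - a + 2 * D) / T ^ (n + 1)) := by
    rw [slabDensity_of_le hab]
    exact (div_le_div_of_nonneg_right hcount_le (by positivity)).trans_eq (by ring)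
  have hle_density : (S + -(2 * D)) ^ n / S ^ n * ((b - a - 2 * D) / T ^ (n + 1)) ≤
      slabDensity R T x a b S := by
    rw [slabDensity_of_le hab]
    exact Eq.trans_le (by ring) (div_le_div_of_nonneg_right hle_count (by positivity))
  have hadd := add_div (b - a) (2 * D) ((T : ℝ) ^ (n + 1))
  have hsub := sub_div (b - a) (2 * D) ((T : ℝ) ^ (n + 1))
  rw [abs_le]
  constructor <;> linarith

theorem exists_eventually_abs_slabDensity_sub_le (hT : 0 < T) (R : Space n ≃ₗᵢ[ℝ] Space n)
    (x : Space n) : ∃ C : ℝ, ∀ a b : ℝ, ∀ᶠ S : ℝ in atTop,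
      |slabDensity R T x a b S - (b - a) / (T : ℝ) ^ (n + 1)| ≤ C := by
  refine ⟨2 * cellRadius n T / (T : ℝ) ^ (n + 1) + 1, fun a b => ?_⟩
  rcases le_total a b with h | h
  · exact eventually_abs_slabDensity_sub_le_of_le hT R x h
  · filter_upwards [eventually_abs_slabDensity_sub_le_of_le hT R x h] with S hS
    rwa [slabDensity_swap, ← neg_sub a b, neg_div, ← neg_sub', abs_neg]

theorem tendsto_of_eventually_abs_natCast_mul_sub_le {α : Type*} {F : Filter α} {f : α → ℝ}
    {l C : ℝ} (h : ∀ k : ℕ, ∀ᶠ s in F, |k * f s - k * l| ≤ C) : Tendsto f F (𝓝 l) := by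
  rw [Metric.tendsto_nhds]
  intro ε hε
  obtain ⟨k, hk⟩ := exists_nat_gt (max (C / ε) 0)
  obtain ⟨hkC, hk0⟩ := max_lt_iff.1 hk
  filter_upwards [h k] with s hs
  rw [← mul_sub, abs_mul, abs_of_pos hk0] at hs
  rw [Real.dist_eq]
  exact lt_of_mul_lt_mul_left (hs.trans_lt ((div_lt_iff₀ hε).1 hkC)) hk0.le

theorem tendsto_slabDensity_natCast_mul_height (hT : 0 < T) (R : Space n ≃ₗᵢ[ℝ] Space n)
    (x : Space n) (a : ℝ) (e : LatticeIndex n) (k : ℕ) :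
    Tendsto (fun S => slabDensity R T x a (a + k * height R (shift T e)) S -
      k * slabDensity R T x a (a + height R (shift T e)) S) atTop (𝓝 0) := by
  induction k with
  | zero => simp [slabDensity_self]
  | succ k ih =>
    have hk : height R (shift T (k • e)) = k * height R (shift T e) := by
      rw [shift_nsmul, map_smul, smul_eq_mul]
    have hsub := ih.add (tendsto_slabDensity_sub hT R (x + shift T (k • e)) x a
      (a + height R (shift T e)))
    rw [add_zero] at hsub
    refine hsub.congr' ?_
    filter_upwards [eventually_ge_atTop 0] with S hS
    have hadd := slabDensity_add hT R hS x a (k * height R (shift T e) + a)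
      (k * height R (shift T e) + (a + height R (shift T e)))
    have htranslate := slabDensity_translate R T x a (a + height R (shift T e)) S (k • e)
    rw [hk] at htranslate
    rw [show a + ((k + 1 : ℕ) : ℝ) * height R (shift T e) =
      k * height R (shift T e) + (a + height R (shift T e)) by push_cast; ring, ← hadd,
      ← htranslate, add_comm a]
    push_cast
    ring

theorem tendsto_slabDensity_height (hT : 0 < T) (R : Space n ≃ₗᵢ[ℝ] Space n) (x : Space n)
    (a : ℝ) (e : LatticeIndex n) :
    Tendsto (slabDensity R T x a (a + height R (shift T e))) atTop
      (𝓝 (height R (shift T e) / (T : ℝ) ^ (n + 1))) := by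
  obtain ⟨C, hC⟩ := exists_eventually_abs_slabDensity_sub_le hT R x
  refine tendsto_of_eventually_abs_natCast_mul_sub_le (C := C + 1) fun k => ?_
  filter_upwards [hC a (a + k * height R (shift T e)), Metric.tendsto_nhds.1
    (tendsto_slabDensity_natCast_mul_height hT R x a e k) 1 one_pos] with S hbd htel
  rw [Real.dist_0_eq_abs, abs_sub_comm] at htel
  rw [add_sub_cancel_left, mul_div_assoc] at hbd
  calc |_| ≤ _ := abs_sub_le _ (slabDensity R T x a (a + k * height R (shift T e)) S) _
    _ ≤ C + 1 := by linarith

/-- The heights of the vectors of the period lattice. -/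
def heightGroup (R : Space n ≃ₗᵢ[ℝ] Space n) (T : ℕ) : AddSubgroup ℝ where
  carrier := Set.range fun e : LatticeIndex n => height R (shift T e)
  add_mem' := by
    rintro _ _ ⟨e, rfl⟩ ⟨f, rfl⟩
    exact ⟨e + f, by simp [shift_add]⟩
  zero_mem' := ⟨0, by simp [shift_zero]⟩
  neg_mem' := by
    rintro _ ⟨e, rfl⟩
    exact ⟨-e, by simp [shift_neg]⟩

theorem mem_heightGroup {t : ℝ} : t ∈ heightGroup R T ↔ ∃ e, height R (shift T e) = t := Iff.rfl

theorem heightGroup_ne_bot (hT : 0 < T) (R : Space n ≃ₗᵢ[ℝ] Space n) : heightGroup R T ≠ ⊥ := by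
  intro hbot
  obtain ⟨z, hz⟩ := exists_sub_shift_mem_cube hT
    ((cellRadius n T + 1) • R (lastBasisVector n))
  have hle := (le_abs_self _).trans ((abs_height_le R _).trans (norm_le_cellRadius hz))
  have hz0 : height R (shift T z) = 0 := by
    rw [← AddSubgroup.mem_bot, ← hbot]
    exact mem_heightGroup.2 ⟨z, rfl⟩
  have haxis : height R (R (lastBasisVector n)) = 1 := by
    simp [height_apply, lastBasisVector]
  rw [map_sub, map_smul, hz0, haxis, smul_eq_mul] at hle
  linarith

theorem tendsto_slabDensity_of_dense (hT : 0 < T)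
    (hd : Dense (heightGroup R T : Set ℝ)) (x : Space n) (a b : ℝ) :
    Tendsto (slabDensity R T x a b) atTop (𝓝 ((b - a) / (T : ℝ) ^ (n + 1))) := by
  have hT' : (0 : ℝ) < (T : ℝ) ^ (n + 1) := pow_pos (by exact_mod_cast hT) _
  refine tendsto_order.2 ⟨fun r hr => ?_, fun r hr => ?_⟩
  · obtain ⟨_, ⟨e, rfl⟩, hre, heb⟩ := hd.exists_between ((lt_div_iff₀ hT').1 hr)
    filter_upwards [(tendsto_slabDensity_height hT R x a e).eventually_const_lt
      ((lt_div_iff₀ hT').2 hre), eventually_ge_atTop 0] with S hS h0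
    exact hS.trans_le (slabDensity_mono hT R h0 x a (by dsimp only at heb; linarith))
  · obtain ⟨_, ⟨e, rfl⟩, hbe, her⟩ := hd.exists_between ((div_lt_iff₀ hT').1 hr)
    filter_upwards [(tendsto_slabDensity_height hT R x a e).eventually_lt_const
      ((div_lt_iff₀ hT').2 her), eventually_ge_atTop 0] with S hS h0
    exact (slabDensity_mono hT R h0 x a (by dsimp only at hbe; linarith)).trans_lt hS

theorem exists_tendsto_slabDensity_of_cyclic (hT : 0 < T) {t : ℝ} (ht : 0 < t)
    (hcyc : heightGroup R T = AddSubgroup.closure {t}) (x : Space n) (a b : ℝ) :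
    ∃ l, Tendsto (slabDensity R T x a b) atTop (𝓝 l) := by
  have hmem : ∀ s, (∃ e, height R (shift T e) = s) ↔ ∃ k : ℤ, k * t = s := fun s => by
    rw [← mem_heightGroup, hcyc, AddSubgroup.mem_closure_singleton]
    simp only [zsmul_eq_mul]
  obtain ⟨e, he⟩ := (hmem ((⌈b / t⌉ - ⌈a / t⌉ : ℤ) * t)).2 ⟨_, rfl⟩
  -- `[a, b)` and `[a, a + height (T e))` contain the same multiples of `t`
  refine ⟨_, (tendsto_slabDensity_height hT R x a e).congr fun S =>
    slabDensity_congr_right fun z => ?_⟩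
  obtain ⟨k, hk⟩ := (hmem _).1 ⟨z, rfl⟩
  rw [← hk, he, ← sub_lt_iff_lt_add, ← sub_mul, ← Int.cast_sub, ← lt_div_iff₀ ht,
    ← lt_div_iff₀ ht, ← Int.lt_ceil, ← Int.lt_ceil]
  omega

theorem exists_tendsto_slabDensity (hT : 0 < T) (R : Space n ≃ₗᵢ[ℝ] Space n) (x : Space n)
    (a b : ℝ) : ∃ l, Tendsto (slabDensity R T x a b) atTop (𝓝 l) := by
  by_cases hmin : ∃ t, IsLeast {s | s ∈ heightGroup R T ∧ 0 < s} t
  · obtain ⟨t, ht⟩ := hmin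
    exact exists_tendsto_slabDensity_of_cyclic hT ht.1.2 (AddSubgroup.cyclic_of_min ht) x a b
  · exact ⟨_, tendsto_slabDensity_of_dense hT
      ((heightGroup R T).dense_of_no_min (heightGroup_ne_bot hT R) hmin) x a b⟩

/-- `G` is a distribution function for the heights of the lattice points in large cylinders. -/
def IsLimitDistribution (R : Space n ≃ₗᵢ[ℝ] Space n) (T : ℕ) (G : ℝ → ℝ) : Prop :=
  ∀ (x : Space n) (a b : ℝ), Tendsto (slabDensity R T x a b) atTop (𝓝 (G b - G a))

theorem exists_isLimitDistribution (hT : 0 < T) (R : Space n ≃ₗᵢ[ℝ] Space n) :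
    ∃ G, IsLimitDistribution R T G := by
  choose G hG using fun b => exists_tendsto_slabDensity hT R (0 : Space n) 0 b
  refine ⟨G, fun x a b => ?_⟩
  have hlim := ((hG b).sub (hG a)).add (tendsto_slabDensity_sub hT R x 0 a b)
  rw [add_zero] at hlim
  refine hlim.congr' ?_
  filter_upwards [eventually_ge_atTop 0] with S hS
  linarith [slabDensity_add hT R hS (0 : Space n) 0 a b]

theorem IsLimitDistribution.monotone (hG : IsLimitDistribution R T G) : Monotone G :=
  fun a b hab => sub_nonneg.1 <| ge_of_tendsto (hG 0 a b) <| by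
    filter_upwards [eventually_ge_atTop 0] with S hS
    exact slabDensity_nonneg hS hab

theorem IsLimitDistribution.add_height (hG : IsLimitDistribution R T G) (hT : 0 < T) (t : ℝ)
    (e : LatticeIndex n) :
    G (t + height R (shift T e)) = G t + height R (shift T e) / (T : ℝ) ^ (n + 1) :=
  eq_add_of_sub_eq' (tendsto_nhds_unique (hG 0 t _) (tendsto_slabDensity_height hT R 0 t e))

theorem IsLimitDistribution.exists_abs_sub_le (hG : IsLimitDistribution R T G) (hT : 0 < T) :
    ∃ C : ℝ, ∀ a b, |G b - G a - (b - a) / (T : ℝ) ^ (n + 1)| ≤ C := by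
  obtain ⟨C, hC⟩ := exists_eventually_abs_slabDensity_sub_le hT R 0
  exact ⟨C, fun a b => le_of_tendsto ((hG 0 a b).sub_const _).abs (hC a b)⟩

end

/-! ### Periodic sums over pairs of sites -/

section

variable {n T : ℕ} {L : Set (Space n)} {c : L → L → ℝ≥0}

/-- The translate of the site `x` by `T z`. -/
def translate (hP : PeriodicSet T L) (x : L) (z : LatticeIndex n) : L :=
  ⟨x + shift T z, (hP z).subset ⟨x, x.2, rfl⟩⟩

@[simp]
theorem coe_translate (hP : PeriodicSet T L) (x : L) (z : LatticeIndex n) :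
    (translate hP x z : Space n) = x + shift T z := rfl

theorem translate_translate (hP : PeriodicSet T L) (x : L) (z w : LatticeIndex n) :
    translate hP (translate hP x z) w = translate hP x (z + w) := by
  apply Subtype.ext
  simp [shift_add, add_assoc]

@[simp]
theorem translate_zero (hP : PeriodicSet T L) (x : L) : translate hP x 0 = x := by
  apply Subtype.ext
  simp [shift_zero]

/-- The bijection of the set of sites given by the translation by `T z`. -/
def translateEquiv (hP : PeriodicSet T L) (z : LatticeIndex n) : L ≃ L where
  toFun x := translate hP x z
  invFun x := translate hP x (-z)
  left_inv x := by simp [translate_translate]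
  right_inv x := by simp [translate_translate]

/-- The sites in the period cell `Q_T`. -/
abbrev BaseSite (T : ℕ) (L : Set (Space n)) : Type := {i : L // (i : Space n) ∈ cube n T}

/-- Every site is the translate of a unique site of the period cell. -/
def baseSiteProdEquiv (hT : 0 < T) (hP : PeriodicSet T L) : BaseSite T L × LatticeIndex n ≃ L :=
  Equiv.ofBijective (fun p => translate hP p.1 p.2) <| by
    constructor
    · rintro ⟨i, z⟩ ⟨j, w⟩ h
      have hij : ((i : L) : Space n) + shift T z = (j : L) + shift T w := congrArg Subtype.val h
      obtain rfl : z = w :=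
        eq_of_sub_shift_mem_cube (T := T) (x := ((i : L) : Space n) + shift T z)
          (by simpa using i.2) (by rw [hij]; simpa using j.2)
      rw [Subtype.ext (Subtype.ext (add_right_cancel hij)) (a1 := i) (a2 := j)]
    · intro x
      obtain ⟨z, hz⟩ := exists_sub_shift_mem_cube hT (x : Space n)
      refine ⟨(⟨translate hP x (-z), ?_⟩, z), by simp [translate_translate]⟩
      simpa [shift_neg, ← sub_eq_add_neg] using hz

theorem baseSiteProdEquiv_apply (hT : 0 < T) (hP : PeriodicSet T L) (i : BaseSite T L)
    (z : LatticeIndex n) : baseSiteProdEquiv hT hP (i, z) = translate hP i z := rfl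

theorem finite_baseSite (T : ℕ) (hL : UniformlyDiscrete L) : Finite (BaseSite T L) := by
  obtain ⟨r, hr, hsep⟩ := hL
  have : DiscreteTopology L := DiscreteTopology.of_forall_le_dist hr fun x y hxy =>
    hsep x x.2 y y.2 (Subtype.coe_injective.ne hxy)
  have hcube : Bornology.IsBounded (cube n T) :=
    Metric.isBounded_closedBall.subset fun x hx =>
      mem_closedBall_zero_iff.2 (norm_le_cellRadius hx)
  have hfin := Metric.finite_isBounded_inter_isClosed ⟨this⟩ hcube
    (Metric.isClosed_of_pairwise_le_dist hr fun x hx y hy => hsep x hx y hy)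
  exact ((hfin.preimage Subtype.val_injective.injOn).subset
    (t := {i : L | (i : Space n) ∈ cube n T}) fun i hi => ⟨hi, i.2⟩).to_subtype

theorem countable_sites (hT : 0 < T) (hL : UniformlyDiscrete L) (hP : PeriodicSet T L) :
    Countable L :=
  have := finite_baseSite T hL
  (baseSiteProdEquiv hT hP).symm.injective.countable

/-- The sum of `F` over the ordered pairs of sites that start in the period cell, weighted by the
coefficients. -/
def cellSum (T : ℕ) (c : L → L → ℝ≥0) (F : L → L → ℝ≥0∞) : ℝ≥0∞ :=
  ∑' i : BaseSite T L, ∑' j : L, c i j * F i j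

section cellSum

variable {f : ℝ → L → L → ℝ≥0∞} {F G : L → L → ℝ≥0∞}

theorem cellSum_mono (h : ∀ i j, F i j ≤ G i j) : cellSum T c F ≤ cellSum T c G :=
  ENNReal.tsum_le_tsum fun i => ENNReal.tsum_le_tsum fun j => by gcongr; exact h i j

theorem cellSum_add : cellSum T c (fun i j => F i j + G i j) = cellSum T c F + cellSum T c G := by
  simp only [cellSum, mul_add, ENNReal.tsum_add]

theorem cellSum_const_mul (a : ℝ≥0∞) :
    cellSum T c (fun i j => a * F i j) = a * cellSum T c F := by
  simp only [cellSum, ← ENNReal.tsum_mul_left, mul_left_comm]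

theorem summable_coeff_mul_one_add_norm (hL : UniformlyDiscrete L) (hd : DecayCoeff c) (i : L) :
    Summable fun j : L => (c i j : ℝ) * (1 + ‖(i : Space n) - j‖) := by
  obtain ⟨r, hr, hsep⟩ := hL
  classical
  refine Summable.of_nonneg_of_le (fun j => by positivity) (fun j => ?_)
    (((hd i).mul_left (1 + r⁻¹)).add (hasSum_pi_single i (c i i : ℝ)).summable)
  by_cases hij : i = j
  · subst hij
    simp
  · have hone : 1 ≤ r⁻¹ * ‖(i : Space n) - j‖ := by
      rw [inv_mul_eq_div, one_le_div hr, ← dist_eq_norm]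
      exact hsep i i.2 j j.2 (Subtype.coe_injective.ne hij)
    rw [Pi.single_eq_of_ne' hij, add_zero, mul_left_comm]
    gcongr
    linarith

theorem cellSum_ne_top (hL : UniformlyDiscrete L) (hd : DecayCoeff c) {C : ℝ}
    (hF : ∀ i j : L, F i j ≤ ENNReal.ofReal (C * (1 + ‖(i : Space n) - j‖))) :
    cellSum T c F ≠ ⊤ := by
  have := finite_baseSite T hL
  have := Fintype.ofFinite (BaseSite T L)
  refine ne_top_of_le_ne_top ?_ (cellSum_mono hF)
  simp only [ENNReal.ofReal_mul' (add_nonneg zero_le_one (norm_nonneg _)), cellSum_const_mul]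
  refine ENNReal.mul_ne_top ENNReal.ofReal_ne_top ?_
  rw [cellSum, tsum_fintype]
  refine ENNReal.sum_ne_top.2 fun i _ => ?_
  convert (summable_coeff_mul_one_add_norm hL hd i).tsum_ofReal_ne_top using 4 with j
  rw [ENNReal.ofReal_mul (NNReal.coe_nonneg _), ENNReal.ofReal_coe_nnreal]

theorem hasSurfaceDensity_cellSum (hL : UniformlyDiscrete L) (hd : DecayCoeff c) {C : ℝ}
    (hf : ∀ᶠ S : ℝ in atTop, ∀ i j : L,
      f S i j ≤ ENNReal.ofReal (C * (1 + ‖(i : Space n) - j‖) * S ^ n))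
    (hlim : ∀ i j, HasSurfaceDensity n (fun S => f S i j) (F i j)) :
    HasSurfaceDensity n (fun S => cellSum T c (f S)) (cellSum T c F) := by
  let _ : MeasurableSpace (BaseSite T L × L) := ⊤
  have hcount : ∀ F : L → L → ℝ≥0∞, cellSum T c F =
      ∫⁻ p : BaseSite T L × L, c p.1 p.2 * F p.1 p.2 ∂Measure.count := fun F => by
    rw [lintegral_count, ENNReal.tsum_prod', cellSum]
  have hdiv : ∀ S, cellSum T c (f S) / ENNReal.ofReal (S ^ n) =
      cellSum T c fun i j => f S i j / ENNReal.ofReal (S ^ n) := fun S => by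
    simp only [ENNReal.div_eq_inv_mul, cellSum_const_mul]
  simp only [HasSurfaceDensity, hdiv]
  simp only [hcount]
  refine tendsto_lintegral_filter_of_dominated_convergence
    (fun p : BaseSite T L × L =>
      c p.1 p.2 * ENNReal.ofReal (C * (1 + ‖((p.1 : L) : Space n) - p.2‖)))
    (Eventually.of_forall fun S => measurable_from_top) ?_ ?_ ?_
  · filter_upwards [hf, eventually_gt_atTop 0] with S hS hS0
    refine Eventually.of_forall fun p => ?_
    gcongr
    refine ENNReal.div_le_of_le_mul ((hS p.1 p.2).trans_eq ?_)
    rw [ENNReal.ofReal_mul' (by positivity)]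
  · rw [← hcount fun i j => ENNReal.ofReal (C * (1 + ‖(i : Space n) - j‖))]
    exact cellSum_ne_top hL hd fun i j => le_rfl
  · exact Eventually.of_forall fun p =>
      ENNReal.Tendsto.const_mul (hlim p.1 p.2) (Or.inr ENNReal.coe_ne_top)

theorem hasSurfaceDensity_cellSum_zero (hL : UniformlyDiscrete L) (hd : DecayCoeff c) {C : ℝ}
    (hf : ∀ᶠ S : ℝ in atTop, ∀ i j : L,
      f S i j ≤ ENNReal.ofReal (C * (1 + ‖(i : Space n) - j‖) * S ^ n))
    (hlim : ∀ i j, HasSurfaceDensity n (fun S => f S i j) 0) :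
    HasSurfaceDensity n (fun S => cellSum T c (f S)) 0 := by
  simpa [cellSum] using hasSurfaceDensity_cellSum (T := T) hL hd hf hlim

end cellSum

/-- The contribution to the energy in `A` of all translates of the ordered pair `(i, j)`, without
the coefficient. -/
def pairEnergy (hP : PeriodicSet T L) (u : L → ℝ) (A : Set (Space n)) (i j : L) : ℝ≥0∞ :=
  ∑' z : LatticeIndex n, {z : LatticeIndex n | (i : Space n) + shift T z ∈ A}.indicator
    (fun z => ENNReal.ofReal (u (translate hP i z) - u (translate hP j z))) z

theorem energy_eq_cellSum (hT : 0 < T) (hP : PeriodicSet T L) (hc : PeriodicCoeff T c) (u : L → ℝ)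
    (A : Set (Space n)) : energy c u A = cellSum T c (pairEnergy hP u A) := by
  have hindicator : energy c u A = ∑' i : L, {i : L | (i : Space n) ∈ A}.indicator
      (fun i => ∑' j : L, c i j * ENNReal.ofReal (u i - u j)) i :=
    tsum_subtype {i : L | (i : Space n) ∈ A}
      fun i : L => ∑' j : L, c i j * ENNReal.ofReal (u i - u j)
  rw [hindicator, ← (baseSiteProdEquiv hT hP).tsum_eq, ENNReal.tsum_prod']
  refine tsum_congr fun i => ?_
  simp_rw [pairEnergy, baseSiteProdEquiv_apply, ← ENNReal.tsum_mul_left]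
  rw [ENNReal.tsum_comm]
  refine tsum_congr fun z => ?_
  by_cases h : ((i : L) : Space n) + shift T z ∈ A
  · rw [Set.indicator_of_mem (by exact h), ← (translateEquiv hP z).tsum_eq]
    refine tsum_congr fun j => ?_
    rw [Set.indicator_of_mem (by exact h)]
    change (c (translate hP i z) (translate hP j z) : ℝ≥0∞) * _ = _
    rw [hc z i j _ _ rfl rfl]
    rfl
  · rw [Set.indicator_of_notMem (by exact h)]
    simp [h]

theorem energy_cube_eq_cellSum (T : ℕ) (c : L → L → ℝ≥0) (u : L → ℝ) :
    energy c u (cube n T) = cellSum T c fun i j => ENNReal.ofReal (u i - u j) := rfl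

end

/-! ### Surface energy of equivariant spins -/

section

variable {n T : ℕ} {L : Set (Space n)} {c : L → L → ℝ≥0} {R : Space n ≃ₗᵢ[ℝ] Space n}
  {hP : PeriodicSet T L} {G : ℝ → ℝ} {v : L → ℝ} {S S' : ℝ}

theorem image_cube_mono (R : Space n ≃ₗᵢ[ℝ] Space n) (h : S ≤ S') :
    R '' cube n S ⊆ R '' cube n S' :=
  Set.image_mono fun x hx k => ⟨by linarith [(hx k).1], by linarith [(hx k).2]⟩

/-- The indices `z` with `x + T z` in the cube `R Q_S` and `T z` at height in `[a, b)`. -/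
def cubeSlab (R : Space n ≃ₗᵢ[ℝ] Space n) (T : ℕ) (S : ℝ) (x : Space n) (a b : ℝ) :
    Set (LatticeIndex n) :=
  {z | x + shift T z ∈ R '' cube n S ∧ a ≤ height R (shift T z) ∧ height R (shift T z) < b}

theorem cubeSlab_subset_slabSet (R : Space n ≃ₗᵢ[ℝ] Space n) (T : ℕ) (S : ℝ) (x : Space n)
    (a b : ℝ) : cubeSlab R T S x a b ⊆ slabSet R T S x a b :=
  fun _ hz => ⟨(image_cube R S ▸ hz.1 :).1, hz.2⟩

theorem eventually_mem_image_cube_iff (R : Space n ≃ₗᵢ[ℝ] Space n) (x : Space n) (a b : ℝ) :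
    ∀ᶠ S : ℝ in atTop, ∀ y, a ≤ height R y → height R y < b →
      (x + y ∈ R '' cube n S ↔ x + y ∈ cylinder R S) := by
  filter_upwards [eventually_ge_atTop (-2 * (height R x + a)),
    eventually_ge_atTop (2 * (height R x + b))] with S hSa hSb y hay hyb
  rw [image_cube]
  refine and_iff_left ?_
  rw [map_add]
  constructor <;> linarith

theorem eventually_cubeSlab_eq_slabSet (R : Space n ≃ₗᵢ[ℝ] Space n) (T : ℕ) (x : Space n)
    (a b : ℝ) : ∀ᶠ S : ℝ in atTop, cubeSlab R T S x a b = slabSet R T S x a b := by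
  filter_upwards [eventually_mem_image_cube_iff R x a b] with S hS
  ext z
  exact and_congr_left fun hz => hS _ hz.1 hz.2

theorem IsLimitDistribution.hasSurfaceDensity_cubeSlab (hG : IsLimitDistribution R T G)
    (hT : 0 < T) (x : Space n) (a b : ℝ) : HasSurfaceDensity n
      (fun S => Measure.count (cubeSlab R T S x a b)) (ENNReal.ofReal (G b - G a)) := by
  refine (ENNReal.tendsto_ofReal (hG x a b)).congr' ?_
  filter_upwards [eventually_cubeSlab_eq_slabSet R T x a b, eventually_gt_atTop 0] with S hS hS0
  rw [ofReal_slabDensity hT R hS0, hS]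

theorem hasSurfaceDensity_count_cubeSlab_diff (hT : 0 < T) (R : Space n ≃ₗᵢ[ℝ] Space n)
    (x y : Space n) (a b : ℝ) : HasSurfaceDensity n (fun S =>
      Measure.count {z ∈ cubeSlab R T S x a b | y + shift T z ∉ R '' cube n S}) 0 := by
  refine (hasSurfaceDensity_count_slabSet_diff hT R x y a b).mono_zero ?_
  filter_upwards [eventually_mem_image_cube_iff R y a b] with S hS
  exact measure_mono fun z hz => ⟨cubeSlab_subset_slabSet R T S x a b hz.1,
    fun h => hz.2 ((hS _ hz.1.2.1 hz.1.2.2).2 h)⟩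

/-- The indicator function of the superlevel set `{v ≥ t}`. -/
def levelSpin (v : L → ℝ) (t : ℝ) (x : L) : ℝ :=
  open Classical in if t ≤ v x then 1 else 0

theorem levelSpin_eq_zero_or_one (v : L → ℝ) (t : ℝ) (x : L) :
    levelSpin v t x = 0 ∨ levelSpin v t x = 1 := by
  by_cases h : t ≤ v x <;> simp [levelSpin, h]

theorem ofReal_levelSpin_sub (v : L → ℝ) (t : ℝ) (x y : L) :
    ENNReal.ofReal (levelSpin v t x - levelSpin v t y) =
      open Classical in if t ≤ v x ∧ v y < t then 1 else 0 := by
  by_cases h1 : t ≤ v x <;> by_cases h2 : t ≤ v y <;> simp [levelSpin, h1, h2]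

/-- `v` grows by the height of the translation vector under translations in the lattice. For
`R e_d = ν` this says that `v - ⟨ν, ·⟩` is periodic. -/
def IsEquivariant (hP : PeriodicSet T L) (R : Space n ≃ₗᵢ[ℝ] Space n) (v : L → ℝ) : Prop :=
  ∀ (x : L) (z : LatticeIndex n), v (translate hP x z) = v x + height R (shift T z)

theorem isEquivariant_height (hP : PeriodicSet T L) (R : Space n ≃ₗᵢ[ℝ] Space n) :
    IsEquivariant hP R fun x => height R x := fun x z => by
  simp only [coe_translate, map_add]

theorem IsEquivariant.exists_abs_sub_height_le (hv : IsEquivariant hP R v) (hT : 0 < T)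
    (hL : UniformlyDiscrete L) : ∃ P : ℝ, ∀ x : L, |v x - height R x| ≤ P := by
  have := finite_baseSite T hL
  obtain ⟨P, hPub⟩ := Finite.bddAbove_range fun i : BaseSite T L => |v i - height R (i : L)|
  refine ⟨P, fun x => ?_⟩
  obtain ⟨⟨i, z⟩, rfl⟩ := (baseSiteProdEquiv hT hP).surjective x
  rw [baseSiteProdEquiv_apply, hv, coe_translate, map_add, add_sub_add_right_eq_sub]
  exact hPub ⟨i, rfl⟩

theorem IsEquivariant.exists_one_add_abs_sub_le (hv : IsEquivariant hP R v) (hT : 0 < T)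
    (hL : UniformlyDiscrete L) :
    ∃ P : ℝ, ∀ x y : L, 1 + |v x - v y| ≤ P * (1 + ‖(x : Space n) - y‖) := by
  obtain ⟨P, hvP⟩ := hv.exists_abs_sub_height_le hT hL
  refine ⟨1 + 2 * P, fun x y => ?_⟩
  have hP0 : 0 ≤ P := (abs_nonneg _).trans (hvP x)
  have hheight := abs_height_le R ((x : Space n) - y)
  rw [map_sub] at hheight
  have hsub : |v x - v y| ≤ P + ‖(x : Space n) - y‖ + P :=
    calc |v x - v y| ≤ |v x - height R x| + |height R x - height R y| + |height R y - v y| :=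
          (abs_sub_le _ (height R y) _).trans (by gcongr; exact abs_sub_le _ _ _)
      _ ≤ P + ‖(x : Space n) - y‖ + P := by
          rw [abs_sub_comm _ (v y)]
          gcongr
          exacts [hvP x, hvP y]
  nlinarith [norm_nonneg ((x : Space n) - y)]

theorem IsEquivariant.exists_count_cubeSlab_le (hv : IsEquivariant hP R v) (hT : 0 < T)
    (hL : UniformlyDiscrete L) : ∃ C : ℝ, ∀ (x : Space n) (i j : L) (t S : ℝ), 1 ≤ S →
      Measure.count (cubeSlab R T S x (t - v i) (t - v j)) ≤
        ENNReal.ofReal (C * (1 + ‖(i : Space n) - j‖) * S ^ n) := by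
  obtain ⟨P, hvP⟩ := hv.exists_one_add_abs_sub_le hT hL
  obtain ⟨C, hC, hcount⟩ := exists_count_slabSet_le n hT
  refine ⟨C * P, fun x i j t S hS => (measure_mono (cubeSlab_subset_slabSet R T S x _ _)).trans
    ((hcount R S _ _ x hS).trans (ENNReal.ofReal_le_ofReal ?_))⟩
  have : 0 ≤ S := zero_le_one.trans hS
  calc C * (1 + |t - v j - (t - v i)|) * S ^ n = C * (1 + |v i - v j|) * S ^ n := by
        rw [sub_sub_sub_cancel_left]
    _ ≤ C * (P * (1 + ‖(i : Space n) - j‖)) * S ^ n := by gcongr; exact hvP i j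
    _ = C * P * (1 + ‖(i : Space n) - j‖) * S ^ n := by ring

theorem tsum_indicator_one (A : Set (LatticeIndex n)) :
    ∑' z, A.indicator (fun _ => (1 : ℝ≥0∞)) z = Measure.count A := by
  rw [← lintegral_count, lintegral_indicator A.to_countable.measurableSet]
  simp

theorem pairEnergy_levelSpin (hv : IsEquivariant hP R v) (t S : ℝ) (i j : L) :
    pairEnergy hP (levelSpin v t) (R '' cube n S) i j =
      Measure.count (cubeSlab R T S i (t - v i) (t - v j)) := by
  classical
  rw [← tsum_indicator_one, pairEnergy]
  refine tsum_congr fun z => ?_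
  simp only [Set.indicator_apply, cubeSlab, Set.mem_ofPred_eq, ofReal_levelSpin_sub, hv _ _,
    ← ite_and, sub_le_iff_le_add', lt_sub_iff_add_lt']

/-- The energy per unit area of the interface of the superlevel set `{v ≥ t}`. -/
def levelDensity (T : ℕ) (c : L → L → ℝ≥0) (G : ℝ → ℝ) (v : L → ℝ) (t : ℝ) : ℝ≥0∞ :=
  cellSum T c fun i j => ENNReal.ofReal (G (t - v j) - G (t - v i))

theorem hasSurfaceDensity_energy_levelSpin (hT : 0 < T) (hL : UniformlyDiscrete L)
    (hc : PeriodicCoeff T c) (hd : DecayCoeff c) (hG : IsLimitDistribution R T G)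
    (hv : IsEquivariant hP R v) (t : ℝ) :
    HasSurfaceDensity n (fun S => energy c (levelSpin v t) (R '' cube n S))
      (levelDensity T c G v t) := by
  obtain ⟨C, hC⟩ := hv.exists_count_cubeSlab_le hT hL
  simp only [energy_eq_cellSum hT hP hc]
  refine hasSurfaceDensity_cellSum hL hd (C := C) ?_ fun i j => ?_
  · filter_upwards [eventually_ge_atTop 1] with S hS i j
    rw [pairEnergy_levelSpin hv]
    exact hC i i j t S hS
  · simp only [pairEnergy_levelSpin hv]
    exact hG.hasSurfaceDensity_cubeSlab hT _ _ _

theorem levelDensity_ne_top (hT : 0 < T) (hL : UniformlyDiscrete L) (hd : DecayCoeff c)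
    (hG : IsLimitDistribution R T G) (hv : IsEquivariant hP R v) (t : ℝ) :
    levelDensity T c G v t ≠ ⊤ := by
  obtain ⟨C, hC⟩ := hv.exists_count_cubeSlab_le hT hL
  refine cellSum_ne_top hL hd (C := C) fun i j =>
    le_of_tendsto (hG.hasSurfaceDensity_cubeSlab hT (i : Space n) (t - v i) (t - v j)) ?_
  filter_upwards [eventually_ge_atTop 1] with S hS
  refine ENNReal.div_le_of_le_mul ((hC i i j t S hS).trans_eq ?_)
  rw [← ENNReal.ofReal_mul' (by positivity)]

theorem energy_union (c : L → L → ℝ≥0) (u : L → ℝ) {A B : Set (Space n)} (h : Disjoint A B) :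
    energy c u (A ∪ B) = energy c u A + energy c u B :=
  ENNReal.summable.tsum_union_disjoint (f := fun i => ∑' j, c i j * ENNReal.ofReal (u i - u j))
    (h.preimage ((↑) : L → Space n)) ENNReal.summable

theorem energy_image_cube_add_energy_diff (c : L → L → ℝ≥0) (u : L → ℝ)
    (R : Space n ≃ₗᵢ[ℝ] Space n) (h : S ≤ S') :
    energy c u (R '' cube n S) + energy c u (R '' cube n S' \ R '' cube n S) =
      energy c u (R '' cube n S') := by
  rw [← energy_union c u Set.disjoint_sdiff_right, Set.union_sdiff_cancel (image_cube_mono R h)]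

theorem hasSurfaceDensity_energy_levelSpin_diff (hT : 0 < T) (hL : UniformlyDiscrete L)
    (hc : PeriodicCoeff T c) (hd : DecayCoeff c) (hG : IsLimitDistribution R T G)
    (hv : IsEquivariant hP R v) (t : ℝ) {θ : ℝ} (hθ0 : 0 < θ) (hθ1 : θ ≤ 1) :
    HasSurfaceDensity n
      (fun S => energy c (levelSpin v t) (R '' cube n S \ R '' cube n (θ * S)))
      (ENNReal.ofReal (1 - θ ^ n) * levelDensity T c G v t) := by
  have hcube := hasSurfaceDensity_energy_levelSpin hT hL hc hd hG hv t
  have hsmall := hcube.comp_mul_left hθ0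
  have hfin := levelDensity_ne_top hT hL hd hG hv t
  have hfin_small : ENNReal.ofReal (θ ^ n) * levelDensity T c G v t ≠ ⊤ :=
    ENNReal.mul_ne_top ENNReal.ofReal_ne_top hfin
  rw [ENNReal.ofReal_sub _ (by positivity), ENNReal.sub_mul fun _ _ => hfin, ENNReal.ofReal_one,
    one_mul]
  refine (ENNReal.Tendsto.sub hcube hsmall (Or.inl hfin)).congr' ?_
  filter_upwards [eventually_gt_atTop 0, hsmall.eventually_lt_const hfin_small.lt_top]
    with S hS hlt
  rw [← energy_image_cube_add_energy_diff c _ R (by nlinarith : θ * S ≤ S), ENNReal.add_div,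
    ENNReal.add_sub_cancel_left hlt.ne]

end

/-! ### The coarea argument -/

section

variable {n T : ℕ} {L : Set (Space n)} {c : L → L → ℝ≥0} {R : Space n ≃ₗᵢ[ℝ] Space n}
  {hP : PeriodicSet T L} {G : ℝ → ℝ} {e : LatticeIndex n}

theorem exists_height_shift_pos (hT : 0 < T) (R : Space n ≃ₗᵢ[ℝ] Space n) :
    ∃ e : LatticeIndex n, 0 < height R (shift T e) := by
  obtain ⟨⟨t, ht⟩, ht0⟩ := AddSubgroup.ne_bot_iff_exists_ne_zero.1 (heightGroup_ne_bot hT R)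
  obtain ⟨e, he⟩ := mem_heightGroup.1 ht
  rcases lt_or_gt_of_ne fun h : t = 0 => ht0 (Subtype.ext h) with h | h
  · exact ⟨-e, by rwa [shift_neg, map_neg, he, neg_pos]⟩
  · exact ⟨e, he ▸ h⟩

theorem intervalIntegral_periodic_comp_sub {K : ℝ → ℝ} {s : ℝ} (hK : Function.Periodic K s)
    (x : ℝ) : ∫ t in (0 : ℝ)..s, K (t - x) = ∫ t in (0 : ℝ)..s, K t := by
  rw [intervalIntegral.integral_comp_sub_right K x, zero_sub, sub_eq_neg_add,
    hK.intervalIntegral_add_eq (-x) 0, zero_add]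

theorem IsLimitDistribution.intervalIntegrable_comp_sub (hG : IsLimitDistribution R T G)
    (x a b : ℝ) : IntervalIntegrable (fun t => G (t - x)) volume a b :=
  Monotone.intervalIntegrable fun _ _ h => hG.monotone (by linarith)

theorem IsLimitDistribution.intervalIntegral_sub (hG : IsLimitDistribution R T G) (hT : 0 < T)
    (e : LatticeIndex n) (x y : ℝ) :
    ∫ t in (0 : ℝ)..height R (shift T e), (G (t - y) - G (t - x)) =
      height R (shift T e) * ((x - y) / (T : ℝ) ^ (n + 1)) := by
  set s := height R (shift T e) with hs
  set q := (T : ℝ) ^ (n + 1)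
  let K : ℝ → ℝ := fun t => G t - t / q
  have hK : Function.Periodic K s := fun t => by
    simp only [K, hs, hG.add_height hT]
    ring
  have hKi : ∀ x, IntervalIntegrable (fun t => K (t - x)) volume 0 s := fun x =>
    (hG.intervalIntegrable_comp_sub x 0 s).sub
      ((by fun_prop : Continuous fun t : ℝ => (t - x) / q).intervalIntegrable 0 s)
  have hsplit : ∀ t, G (t - y) - G (t - x) = K (t - y) - K (t - x) + (x - y) / q := fun t => by
    simp only [K]
    ring
  simp_rw [hsplit]
  rw [intervalIntegral.integral_add ((hKi y).sub (hKi x)) intervalIntegrable_const,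
    intervalIntegral.integral_sub (hKi y) (hKi x), intervalIntegral_periodic_comp_sub hK,
    intervalIntegral_periodic_comp_sub hK, sub_self, zero_add, intervalIntegral.integral_const,
    sub_zero, smul_eq_mul]

theorem IsLimitDistribution.lintegral_sub (hG : IsLimitDistribution R T G) (hT : 0 < T)
    (he : 0 < height R (shift T e)) (x y : ℝ) :
    ∫⁻ t in Set.Ioc 0 (height R (shift T e)), ENNReal.ofReal (G (t - y) - G (t - x)) =
      ENNReal.ofReal (height R (shift T e)) * ENNReal.ofReal ((x - y) / (T : ℝ) ^ (n + 1)) := by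
  rcases le_total y x with h | h
  · rw [← ofReal_integral_eq_lintegral_ofReal, ← intervalIntegral.integral_of_le he.le,
      hG.intervalIntegral_sub hT, ENNReal.ofReal_mul he.le]
    · exact ((hG.intervalIntegrable_comp_sub y _ _).sub (hG.intervalIntegrable_comp_sub x _ _)).1
    · exact Eventually.of_forall fun t => sub_nonneg.2 (hG.monotone (by linarith))
  · have hzero : ∀ t, ENNReal.ofReal (G (t - y) - G (t - x)) = 0 := fun t =>
      ENNReal.ofReal_of_nonpos (sub_nonpos.2 (hG.monotone (by linarith)))
    rw [ENNReal.ofReal_of_nonpos (div_nonpos_of_nonpos_of_nonneg (sub_nonpos.2 h) (by positivity))]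
    simp [hzero]

theorem IsLimitDistribution.measurable_ofReal_sub (hG : IsLimitDistribution R T G) (x y : ℝ) :
    Measurable fun t => ENNReal.ofReal (G (t - y) - G (t - x)) := by
  have := hG.monotone.measurable
  fun_prop

theorem IsLimitDistribution.lintegral_levelDensity (hG : IsLimitDistribution R T G) (hT : 0 < T)
    (hL : UniformlyDiscrete L) (hP : PeriodicSet T L) (c : L → L → ℝ≥0) (v : L → ℝ)
    (he : 0 < height R (shift T e)) :
    ∫⁻ t in Set.Ioc 0 (height R (shift T e)), levelDensity T c G v t =
      ENNReal.ofReal (height R (shift T e)) * (energy c v (cube n T) / (T : ℝ≥0∞) ^ (n + 1)) := by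
  have := countable_sites hT hL hP
  have hmeas := hG.measurable_ofReal_sub
  simp only [levelDensity, cellSum]
  rw [lintegral_tsum fun i =>
    (Measurable.tsum fun j => (hmeas _ _).const_mul _).aemeasurable]
  simp_rw [lintegral_tsum fun _ => ((hmeas _ _).const_mul _).aemeasurable,
    lintegral_const_mul _ (hmeas _ _), hG.lintegral_sub hT he,
    ENNReal.ofReal_div_of_pos (show (0 : ℝ) < (T : ℝ) ^ (n + 1) by positivity),
    ENNReal.ofReal_pow (Nat.cast_nonneg T), ENNReal.ofReal_natCast]
  rw [energy_cube_eq_cellSum, cellSum, div_eq_mul_inv, ← ENNReal.tsum_mul_right,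
    ← ENNReal.tsum_mul_left]
  refine tsum_congr fun i => ?_
  rw [← ENNReal.tsum_mul_right, ← ENNReal.tsum_mul_left]
  exact tsum_congr fun _ => by rw [div_eq_mul_inv]; ring

theorem measurable_levelDensity (hG : IsLimitDistribution R T G) (hT : 0 < T)
    (hL : UniformlyDiscrete L) (hP : PeriodicSet T L) (c : L → L → ℝ≥0) (v : L → ℝ) :
    Measurable (levelDensity T c G v) := by
  have := countable_sites hT hL hP
  exact Measurable.tsum fun i => Measurable.tsum fun j =>
    (hG.measurable_ofReal_sub _ _).const_mul _

/-- By the coarea formula the energy of `v` is the average of the energies of its level sets. -/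
theorem IsLimitDistribution.exists_levelDensity_le (hG : IsLimitDistribution R T G) (hT : 0 < T)
    (hL : UniformlyDiscrete L) (hP : PeriodicSet T L) (c : L → L → ℝ≥0) (v : L → ℝ) :
    ∃ t, levelDensity T c G v t ≤ energy c v (cube n T) / (T : ℝ≥0∞) ^ (n + 1) := by
  obtain ⟨e, he⟩ := exists_height_shift_pos hT R
  have hs : ENNReal.ofReal (height R (shift T e)) ≠ 0 := by simpa using he
  obtain ⟨t, ht⟩ := exists_le_laverage (μ := volume.restrict (Set.Ioc 0 (height R (shift T e))))
    (by simpa using he) (measurable_levelDensity hG hT hL hP c v).aemeasurable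
  refine ⟨t, ht.trans_eq ?_⟩
  rw [laverage_eq, hG.lintegral_levelDensity hT hL hP c v he, Measure.restrict_apply_univ,
    Real.volume_Ioc, sub_zero, mul_comm, ENNReal.mul_div_cancel_right hs ENNReal.ofReal_ne_top]

end

/-! ### Gluing along the boundary of a cube -/

section

variable {n T : ℕ} {L : Set (Space n)} {c : L → L → ℝ≥0} {R : Space n ≃ₗᵢ[ℝ] Space n}
  {hP : PeriodicSet T L} {G : ℝ → ℝ} {u₁ u₂ v : L → ℝ} {δ : ℝ} {ν : Space n}

/-- The indicator function of the half space of sites of nonnegative height: the function `u_ν`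
restricted to `L` when `R e_d = ν`. -/
abbrev flatSpin (R : Space n ≃ₗᵢ[ℝ] Space n) : L → ℝ := levelSpin (fun x => height R x) 0

theorem halfSpaceSpin_eq_flatSpin (hR : R (lastBasisVector n) = ν) (x : L) :
    halfSpaceSpin ν x = flatSpin R x := by
  simp [halfSpaceSpin, levelSpin, inner_eq_height hR]

/-- The function equal to `u₁` on the sites in `A` and to `u₂` on the other sites. -/
def glue (A : Set (Space n)) (u₁ u₂ : L → ℝ) (x : L) : ℝ :=
  open Classical in if (x : Space n) ∈ A then u₁ x else u₂ x

theorem glue_of_mem {A : Set (Space n)} {x : L} (h : (x : Space n) ∈ A) :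
    glue A u₁ u₂ x = u₁ x :=
  if_pos h

theorem glue_of_notMem {A : Set (Space n)} {x : L} (h : (x : Space n) ∉ A) :
    glue A u₁ u₂ x = u₂ x :=
  if_neg h

/-- The translates of the pair `(i, j)` which cross the boundary of `A` and at whose second site
`u₁` and `u₂` differ. -/
def crossingSet (hP : PeriodicSet T L) (A : Set (Space n)) (u₁ u₂ : L → ℝ) (i j : L) :
    Set (LatticeIndex n) :=
  {z | ¬((i : Space n) + shift T z ∈ A ↔ (j : Space n) + shift T z ∈ A) ∧
    u₁ (translate hP j z) ≠ u₂ (translate hP j z)}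

theorem ofReal_sub_le_add_one {p q r : ℝ} (h : |q - r| ≤ 1) :
    ENNReal.ofReal (p - q) ≤ ENNReal.ofReal (p - r) + 1 := by
  rw [← ENNReal.ofReal_one]
  refine (ENNReal.ofReal_le_ofReal ?_).trans ENNReal.ofReal_add_le
  linarith [(abs_le.1 h).1]

theorem pairEnergy_glue_le (hP : PeriodicSet T L) (hu : ∀ x, |u₁ x - u₂ x| ≤ 1)
    (A B : Set (Space n)) (i j : L) :
    pairEnergy hP (glue A u₁ u₂) B i j ≤ pairEnergy hP u₁ A i j + pairEnergy hP u₂ (B \ A) i j +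
      Measure.count (crossingSet hP A u₁ u₂ i j) := by
  classical
  rw [← tsum_indicator_one, pairEnergy, pairEnergy, pairEnergy, ← ENNReal.tsum_add,
    ← ENNReal.tsum_add]
  refine ENNReal.tsum_le_tsum fun z => ?_
  simp only [Set.indicator_apply, Set.mem_ofPred_eq, Set.mem_sdiff, crossingSet, glue,
    coe_translate]
  by_cases hB : (i : Space n) + shift T z ∈ B
  swap
  · simp only [hB, if_false, zero_le]
  by_cases hj : u₁ (translate hP j z) = u₂ (translate hP j z)
  · by_cases hi : (i : Space n) + shift T z ∈ A <;> simp [hB, hi, hj]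
  by_cases hiA : (i : Space n) + shift T z ∈ A <;>
    by_cases hjA : (j : Space n) + shift T z ∈ A
  · simp [hB, hiA, hjA]
  · simpa [hB, hj, hiA, hjA] using ofReal_sub_le_add_one (abs_sub_comm (u₂ _) _ ▸ hu _)
  · simpa [hB, hj, hiA, hjA] using ofReal_sub_le_add_one (hu _)
  · simp [hB, hiA, hjA]

theorem energy_glue_le (hT : 0 < T) (hP : PeriodicSet T L) (hc : PeriodicCoeff T c)
    (hu : ∀ x, |u₁ x - u₂ x| ≤ 1) (A B : Set (Space n)) :
    energy c (glue A u₁ u₂) B ≤ energy c u₁ A + energy c u₂ (B \ A) +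
      cellSum T c fun i j => Measure.count (crossingSet hP A u₁ u₂ i j) := by
  simp only [energy_eq_cellSum hT hP hc, ← cellSum_add]
  exact cellSum_mono fun i j => pairEnergy_glue_le hP hu A B i j

theorem abs_levelSpin_sub_le_one (v w : L → ℝ) (s t : ℝ) (x : L) :
    |levelSpin v s x - levelSpin w t x| ≤ 1 := by
  rcases levelSpin_eq_zero_or_one v s x with h | h <;>
    rcases levelSpin_eq_zero_or_one w t x with h' | h' <;> simp [h, h']

theorem height_mem_Ico_of_levelSpin_ne {P t : ℝ} (hv : ∀ x : L, |v x - height R x| ≤ P) {x : L}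
    (h : levelSpin v t x ≠ flatSpin R x) :
    height R x ∈ Set.Ico (-(P + |t|)) (P + |t|) := by
  have hx := abs_le.1 (hv x)
  have ht := neg_abs_le t
  have ht' := le_abs_self t
  by_cases htv : t ≤ v x <;> by_cases h0 : 0 ≤ height R (x : Space n)
  · simp [levelSpin, htv, h0] at h
  · constructor <;> linarith
  · constructor <;> linarith
  · simp [levelSpin, htv, h0] at h

theorem crossingSet_levelSpin_subset {P t : ℝ} (hv : ∀ x : L, |v x - height R x| ≤ P) (S : ℝ)
    (i j : L) :
    crossingSet hP (R '' cube n S) (levelSpin v t) (flatSpin R) i j ⊆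
      {z ∈ cubeSlab R T S i (-(P + |t|) - height R j) (P + |t| - height R j) |
        (j : Space n) + shift T z ∉ R '' cube n S} ∪
      {z ∈ cubeSlab R T S j (-(P + |t|) - height R j) (P + |t| - height R j) |
        (i : Space n) + shift T z ∉ R '' cube n S} := by
  rintro z ⟨hz, hne⟩
  obtain ⟨hlow, hhigh⟩ := height_mem_Ico_of_levelSpin_ne hv hne
  rw [coe_translate, map_add] at hlow hhigh
  have hslab : -(P + |t|) - height R j ≤ height R (shift T z) ∧
      height R (shift T z) < P + |t| - height R j := ⟨by linarith, by linarith⟩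
  by_cases hi : (i : Space n) + shift T z ∈ R '' cube n S
  · exact Or.inl ⟨⟨hi, hslab⟩, fun hj => hz (iff_of_true hi hj)⟩
  · exact Or.inr ⟨⟨by_contra fun hj => hz (iff_of_false hi hj), hslab⟩, hi⟩

theorem hasSurfaceDensity_cellSum_crossingSet (hT : 0 < T) (hL : UniformlyDiscrete L)
    (hd : DecayCoeff c) (hv : IsEquivariant hP R v) (t : ℝ) :
    HasSurfaceDensity n (fun S => cellSum T c fun i j => Measure.count
      (crossingSet hP (R '' cube n S) (levelSpin v t) (flatSpin R)
        i j)) 0 := by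
  obtain ⟨P, hvP⟩ := hv.exists_abs_sub_height_le hT hL
  obtain ⟨C, hC, hcount⟩ := exists_count_slabSet_le n hT
  set M := P + |t|
  have hslab : ∀ S, 1 ≤ S → ∀ (j : L) (x : Space n),
      Measure.count (cubeSlab R T S x (-M - height R j) (M - height R j)) ≤
        ENNReal.ofReal (C * (1 + |M + M|) * S ^ n) := fun S hS j x => by
    refine (measure_mono (cubeSlab_subset_slabSet R T S x _ _)).trans ?_
    rw [show M + M = M - height R j - (-M - height R j) by ring]
    exact hcount R S _ _ x hS
  refine hasSurfaceDensity_cellSum_zero hL hd (C := 2 * (C * (1 + |M + M|))) ?_ fun i j => ?_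
  · filter_upwards [eventually_ge_atTop 1] with S hS i j
    refine (measure_mono (crossingSet_levelSpin_subset hvP S i j)).trans
      ((measure_union_le _ _).trans
        ((add_le_add ((measure_mono (Set.sep_subset _ _)).trans (hslab S hS j i))
          ((measure_mono (Set.sep_subset _ _)).trans (hslab S hS j j))).trans ?_))
    rw [← ENNReal.ofReal_add (by positivity) (by positivity), ← two_mul, ← mul_assoc]
    refine ENNReal.ofReal_le_ofReal (mul_le_mul_of_nonneg_right ?_ (by positivity))
    exact le_mul_of_one_le_right (by positivity) (le_add_of_nonneg_right (norm_nonneg _))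
  · have hdiff := (hasSurfaceDensity_count_cubeSlab_diff hT R i j (-M - height R j)
      (M - height R j)).add (hasSurfaceDensity_count_cubeSlab_diff hT R j i (-M - height R j)
        (M - height R j))
    rw [add_zero] at hdiff
    exact hdiff.mono_zero (Eventually.of_forall fun S =>
      (measure_mono (crossingSet_levelSpin_subset hvP S i j)).trans (measure_union_le _ _))

theorem dirichletCell_le_energy_glue (hR : R (lastBasisVector n) = ν) (c : L → L → ℝ≥0)
    (v : L → ℝ) (t δ S : ℝ) :
    dirichletCell c R ν δ S ≤ energy c (glue (R '' cube n ((1 - δ) * S)) (levelSpin v t)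
      (flatSpin R)) (R '' cube n S) := by
  refine iInf₂_le _ ⟨fun x => ?_, fun x hx => ?_⟩
  · by_cases h : (x : Space n) ∈ R '' cube n ((1 - δ) * S)
    · rw [glue_of_mem h]
      exact levelSpin_eq_zero_or_one _ _ _
    · rw [glue_of_notMem h]
      exact levelSpin_eq_zero_or_one _ _ _
  · rw [glue_of_notMem hx, halfSpaceSpin_eq_flatSpin hR]

theorem limsup_dirichletCell_le (hT : 0 < T) (hL : UniformlyDiscrete L) (hc : PeriodicCoeff T c)
    (hd : DecayCoeff c) (hR : R (lastBasisVector n) = ν) (hG : IsLimitDistribution R T G)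
    (hv : IsEquivariant hP R v) (t : ℝ) (hδ : δ ∈ Set.Ioo (0 : ℝ) 1) :
    limsup (fun S => dirichletCell c R ν δ S / ENNReal.ofReal (S ^ n)) atTop ≤
      ENNReal.ofReal ((1 - δ) ^ n) * levelDensity T c G v t +
        ENNReal.ofReal (1 - (1 - δ) ^ n) *
          levelDensity T c G (fun x : L => height R x) 0 := by
  have hθ0 : 0 < 1 - δ := sub_pos.2 hδ.2
  have hinner := (hasSurfaceDensity_energy_levelSpin hT hL hc hd hG hv t).comp_mul_left hθ0
  have houter := hasSurfaceDensity_energy_levelSpin_diff hT hL hc hd hG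
    (isEquivariant_height hP R) 0 hθ0 (sub_le_self 1 hδ.1.le)
  have hcross := (hasSurfaceDensity_cellSum_crossingSet hT hL hd hv t).comp_mul_left hθ0
  have hlim := (hinner.add houter).add hcross
  rw [mul_zero, add_zero] at hlim
  rw [← hlim.limsup_eq]
  refine limsup_le_limsup (Eventually.of_forall fun S => ?_)
  exact ENNReal.div_le_div_right ((dirichletCell_le_energy_glue hR c v t δ S).trans
    (energy_glue_le hT hP hc (abs_levelSpin_sub_le_one _ _ _ _) _ _)) _

end

/-! ### The cell formula -/

section

variable {n T : ℕ} {L : Set (Space n)} {c : L → L → ℝ≥0}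
  {u : L → ℝ} {ν : Space n} {t : ℝ}

theorem energy_add_le (c : L → L → ℝ≥0) (u v : L → ℝ) (A : Set (Space n)) :
    energy c (fun x => u x + v x) A ≤ energy c u A + energy c v A := by
  simp only [energy, ← ENNReal.tsum_add, ← mul_add]
  refine ENNReal.tsum_le_tsum fun i => ENNReal.tsum_le_tsum fun j => ?_
  rw [add_sub_add_comm]
  gcongr
  exact ENNReal.ofReal_add_le

theorem energy_const_mul (c : L → L → ℝ≥0) (u : L → ℝ) (A : Set (Space n)) (ht : 0 ≤ t) :
    energy c (fun x => t * u x) A = ENNReal.ofReal t * energy c u A := by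
  simp only [energy, ← ENNReal.tsum_mul_left, ← mul_sub, ENNReal.ofReal_mul ht, mul_left_comm]

theorem periodicCell_le_energy (c : L → L → ℝ≥0)
    (hu : PeriodicFun T fun i : L => u i - inner ℝ ν (i : Space n)) :
    periodicCell T c ν ≤ energy c u (cube n T) :=
  iInf₂_le u hu

theorem periodicCell_add_le (T : ℕ) (c : L → L → ℝ≥0) (μ ν : Space n) :
    periodicCell T c (μ + ν) ≤ periodicCell T c μ + periodicCell T c ν := by
  rw [periodicCell, periodicCell, periodicCell]
  simp only [ENNReal.iInf_add, ENNReal.add_iInf]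
  refine le_iInf₂ fun v hv => le_iInf₂ fun u hu => ?_
  refine (periodicCell_le_energy c fun z x y hxy => ?_).trans (energy_add_le c u v _)
  simp only [inner_add_left, add_sub_add_comm]
  exact congrArg₂ (· + ·) (hu z x y hxy) (hv z x y hxy)

theorem periodicCell_smul_le (T : ℕ) (c : L → L → ℝ≥0) (ν : Space n) (ht : 0 < t) :
    periodicCell T c (t • ν) ≤ ENNReal.ofReal t * periodicCell T c ν := by
  rw [periodicCell.eq_def T c ν]
  simp only [ENNReal.mul_iInf_of_ne (ENNReal.ofReal_pos.2 ht).ne' ENNReal.ofReal_ne_top]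
  refine le_iInf₂ fun u hu => ?_
  rw [← energy_const_mul c u _ ht.le]
  refine periodicCell_le_energy c fun z x y hxy => ?_
  simp only [real_inner_smul_left, ← mul_sub]
  exact congrArg (t * ·) (hu z x y hxy)

theorem periodicCell_smul (T : ℕ) (c : L → L → ℝ≥0) (ν : Space n) (ht : 0 < t) :
    periodicCell T c (t • ν) = ENNReal.ofReal t * periodicCell T c ν := by
  refine (periodicCell_smul_le T c ν ht).antisymm ?_
  have hinv := periodicCell_smul_le T c (t • ν) (inv_pos.2 ht)
  rw [inv_smul_smul₀ ht.ne'] at hinv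
  calc ENNReal.ofReal t * periodicCell T c ν
      ≤ ENNReal.ofReal t * (ENNReal.ofReal t⁻¹ * periodicCell T c (t • ν)) := by gcongr
    _ = periodicCell T c (t • ν) := by
        rw [← mul_assoc, ← ENNReal.ofReal_mul ht.le, mul_inv_cancel₀ ht.ne', ENNReal.ofReal_one,
          one_mul]

theorem periodicCell_ne_top (T : ℕ) (hL : UniformlyDiscrete L) (hd : DecayCoeff c) (ν : Space n) :
    periodicCell T c ν ≠ ⊤ := by
  refine ne_top_of_le_ne_top ?_
    (periodicCell_le_energy (u := fun x : L => inner ℝ ν (x : Space n)) c fun z x y _ => by simp)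
  rw [energy_cube_eq_cellSum]
  refine cellSum_ne_top hL hd (C := ‖ν‖) fun i j => ENNReal.ofReal_le_ofReal ?_
  rw [← inner_sub_right]
  refine (real_inner_le_norm _ _).trans ?_
  gcongr
  exact le_add_of_nonneg_left zero_le_one

/-- The energy density given by the periodic cell formula. -/
def cellDensity (T : ℕ) (c : L → L → ℝ≥0) (ν : Space n) : ℝ≥0 :=
  (periodicCell T c ν / (T : ℝ≥0∞) ^ (n + 1)).toNNReal

theorem coe_cellDensity (hT : 0 < T) (hL : UniformlyDiscrete L) (hd : DecayCoeff c)
    (ν : Space n) : (cellDensity T c ν : ℝ≥0∞) = periodicCell T c ν / (T : ℝ≥0∞) ^ (n + 1) :=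
  ENNReal.coe_toNNReal (ENNReal.div_ne_top (periodicCell_ne_top T hL hd ν)
    (pow_ne_zero _ (Nat.cast_ne_zero.2 hT.ne')))

theorem cellDensity_smul (hT : 0 < T) (hL : UniformlyDiscrete L) (hd : DecayCoeff c) {t : ℝ≥0}
    (ht : 0 < t) (ν : Space n) : cellDensity T c ((t : ℝ) • ν) = t * cellDensity T c ν := by
  rw [← ENNReal.coe_inj, ENNReal.coe_mul, coe_cellDensity hT hL hd, coe_cellDensity hT hL hd,
    periodicCell_smul T c ν (NNReal.coe_pos.2 ht), ENNReal.ofReal_coe_nnreal, mul_div_assoc]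

theorem cellDensity_zero (T : ℕ) (c : L → L → ℝ≥0) : cellDensity T c 0 = 0 := by
  have hzero : periodicCell T c 0 = 0 :=
    le_bot_iff.1 ((periodicCell_le_energy (u := 0) c fun z x y _ => by simp).trans_eq
      (by simp [energy]))
  rw [cellDensity, hzero, ENNReal.zero_div, ENNReal.toNNReal_zero]

theorem cellDensity_add_le (hT : 0 < T) (hL : UniformlyDiscrete L) (hd : DecayCoeff c)
    (μ ν : Space n) : cellDensity T c (μ + ν) ≤ cellDensity T c μ + cellDensity T c ν := by
  rw [← ENNReal.coe_le_coe, ENNReal.coe_add, coe_cellDensity hT hL hd, coe_cellDensity hT hL hd,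
    coe_cellDensity hT hL hd, ← ENNReal.add_div]
  exact ENNReal.div_le_div_right (periodicCell_add_le T c μ ν) _

theorem convexOn_cellDensity (hT : 0 < T) (hL : UniformlyDiscrete L) (hd : DecayCoeff c) :
    ConvexOn ℝ Set.univ fun ν => (cellDensity T c ν : ℝ) := by
  have hsmul : ∀ (t : ℝ≥0) ν, cellDensity T c ((t : ℝ) • ν) = t * cellDensity T c ν := by
    intro t ν
    rcases eq_zero_or_pos t with rfl | ht
    · simp [cellDensity_zero]
    · exact cellDensity_smul hT hL hd ht ν
  refine ⟨convex_univ, fun x _ y _ a b ha hb _ => ?_⟩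
  lift a to ℝ≥0 using ha
  lift b to ℝ≥0 using hb
  have hadd := cellDensity_add_le hT hL hd ((a : ℝ) • x) ((b : ℝ) • y)
  rw [hsmul, hsmul] at hadd
  exact_mod_cast hadd

theorem IsHomogenizedDensity.apply_zero {R : Space n → (Space n ≃ₗᵢ[ℝ] Space n)}
    {φ : Space n → ℝ≥0} (hφ : IsHomogenizedDensity c R φ) : φ 0 = 0 := by
  have h := hφ.homogeneous 2 0 two_pos
  rw [smul_zero, two_mul] at h
  exact left_eq_add.1 h

theorem IsHomogenizedDensity.eq_of_norm_eq_one {R : Space n → (Space n ≃ₗᵢ[ℝ] Space n)}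
    {φ ψ : Space n → ℝ≥0} (hφ : IsHomogenizedDensity c R φ) (hψ : IsHomogenizedDensity c R ψ)
    (hν : ‖ν‖ = 1) : φ ν = ψ ν := by
  obtain ⟨g, hg, hgφ⟩ := hφ.cell_limit ν hν
  obtain ⟨h, hh, hhψ⟩ := hψ.cell_limit ν hν
  rw [← ENNReal.coe_inj]
  refine tendsto_nhds_unique (hgφ.congr' ?_) hhψ
  filter_upwards [Ioo_mem_nhdsGT one_pos] with δ hδ
  exact tendsto_nhds_unique (hg δ hδ) (hh δ hδ)

theorem IsHomogenizedDensity.eq {R : Space n → (Space n ≃ₗᵢ[ℝ] Space n)}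
    {φ ψ : Space n → ℝ≥0} (hφ : IsHomogenizedDensity c R φ) (hψ : IsHomogenizedDensity c R ψ) :
    φ = ψ := by
  funext ν
  rcases eq_or_ne ν 0 with rfl | hν
  · rw [hφ.apply_zero, hψ.apply_zero]
  · have hunit : ‖‖ν‖⁻¹ • ν‖ = 1 := norm_smul_inv_norm hν
    have hpolar : ν = (‖ν‖₊ : ℝ) • (‖ν‖⁻¹ • ν) := by
      rw [coe_nnnorm, smul_inv_smul₀ (norm_ne_zero_iff.2 hν)]
    rw [hpolar, hφ.homogeneous _ _ (nnnorm_pos.2 hν), hψ.homogeneous _ _ (nnnorm_pos.2 hν),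
      hφ.eq_of_norm_eq_one hψ hunit]

end

/-! ### Energy outside of a cube -/

section

variable {n T : ℕ} {L : Set (Space n)} {R : Space n ≃ₗᵢ[ℝ] Space n}
  {G : ℝ → ℝ} {s r S S' κ θ : ℝ} {x y : Space n}

theorem mem_image_cube_of_norm_sub_le {m : ℝ} (hx : x ∈ R '' cube n S) (hxy : ‖x - y‖ ≤ m)
    (h : S + 2 * m ≤ S') : y ∈ R '' cube n S' := by
  rw [image_cube] at hx ⊢
  exact mem_slabBox_of_norm_sub_le hx hxy h (by linarith) (by linarith)

theorem exists_count_image_cube_le (n : ℕ) (hT : 0 < T) :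
    ∃ C : ℝ, 0 < C ∧ ∀ (R : Space n ≃ₗᵢ[ℝ] Space n) (S : ℝ) (x : Space n), 1 ≤ S →
      Measure.count {z : LatticeIndex n | x + shift T z ∈ R '' cube n S} ≤
        ENNReal.ofReal (C * (1 + S) * S ^ n) := by
  obtain ⟨C, hC, hcount⟩ := exists_count_slabSet_le n hT
  refine ⟨C, hC, fun R S x hS => ?_⟩
  have hslab := hcount R S (-(S / 2) - height R x) (S / 2 - height R x) x hS
  rw [show S / 2 - height R x - (-(S / 2) - height R x) = S by ring,
    abs_of_nonneg (zero_le_one.trans hS)] at hslab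
  refine (measure_mono fun z hz => mem_slabSet_iff.2 ?_).trans hslab
  rw [add_sub_cancel, add_sub_cancel, ← image_cube]
  exact hz

/-- The indices `z` which move `x` out of the cube `R Q_r` and `y` into the cube `R Q_s`. -/
def farSet (R : Space n ≃ₗᵢ[ℝ] Space n) (T : ℕ) (s r : ℝ) (x y : Space n) :
    Set (LatticeIndex n) :=
  {z | x + shift T z ∉ R '' cube n r ∧ y + shift T z ∈ R '' cube n s}

theorem farSet_eq_empty (h : s + 2 * ‖x - y‖ ≤ r) : farSet R T s r x y = ∅ :=
  Set.eq_empty_of_forall_notMem fun z hz =>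
    hz.1 (mem_image_cube_of_norm_sub_le hz.2 (by rw [add_sub_add_right_eq_sub, norm_sub_rev]) h)

theorem exists_count_farSet_le (hT : 0 < T) (R : Space n ≃ₗᵢ[ℝ] Space n) (hκ : 0 < κ)
    (hκ1 : κ ≤ 1) (hκθ : κ < θ) : ∃ C : ℝ, ∀ (S : ℝ) (x y : Space n), κ⁻¹ ≤ S →
      Measure.count (farSet R T (κ * S) (θ * S) x y) ≤
        ENNReal.ofReal (C * (1 + ‖x - y‖) * S ^ n) := by
  obtain ⟨C, hC, hcount⟩ := exists_count_image_cube_le n hT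
  have hgap : 0 < θ - κ := sub_pos.2 hκθ
  refine ⟨C * (1 + 2 / (θ - κ)), fun S x y hS => ?_⟩
  have hS0 : 0 < S := (inv_pos.2 hκ).trans_le hS
  rcases le_or_gt (κ * S + 2 * ‖x - y‖) (θ * S) with h | h
  · rw [farSet_eq_empty h, measure_empty]
    exact zero_le
  · have hκS : κ * S ≤ S := mul_le_of_le_one_left hS0.le hκ1
    have hSxy : S ≤ 2 / (θ - κ) * ‖x - y‖ := by
      rw [div_mul_eq_mul_div, le_div_iff₀ hgap]
      linarith
    have hsize : 1 + κ * S ≤ (1 + 2 / (θ - κ)) * (1 + ‖x - y‖) := by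
      have : 0 ≤ 2 / (θ - κ) := by positivity
      linarith [norm_nonneg (x - y)]
    refine (measure_mono fun z hz => hz.2).trans
      ((hcount R (κ * S) y ((inv_le_iff_one_le_mul₀' hκ).1 hS)).trans
        (ENNReal.ofReal_le_ofReal ?_))
    rw [mul_assoc C (1 + 2 / (θ - κ))]
    gcongr

theorem hasSurfaceDensity_count_farSet (R : Space n ≃ₗᵢ[ℝ] Space n) (T : ℕ) (hκθ : κ < θ)
    (x y : Space n) :
    HasSurfaceDensity n (fun S => Measure.count (farSet R T (κ * S) (θ * S) x y)) 0 := by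
  refine hasSurfaceDensity_zero_of_eventually ?_
  filter_upwards [eventually_ge_atTop (2 * ‖x - y‖ / (θ - κ))] with S hS
  rw [div_le_iff₀' (sub_pos.2 hκθ)] at hS
  rw [farSet_eq_empty (by linarith), measure_empty]

theorem hasSum_indicator_one {A : Set (LatticeIndex n)} (hA : Measure.count A ≠ ⊤) :
    HasSum (A.indicator fun _ => (1 : ℝ)) (Measure.count.real A) := by
  rw [← tsum_indicator_one] at hA
  convert ENNReal.hasSum_toReal hA using 1
  · funext z
    by_cases h : z ∈ A <;> simp [h]
  · rw [Measure.real, ← tsum_indicator_one, ENNReal.tsum_toReal_eq fun z => ?_]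
    by_cases h : z ∈ A <;> simp [h]

/-- The signed number of lattice translates of the pair `(x, y)`, with the translate of `x` in the
cube `R Q_r`, that are separated by the hyperplane of height `0`. -/
def cubeFlux (R : Space n ≃ₗᵢ[ℝ] Space n) (T : ℕ) (r : ℝ) (x y : Space n) : ℝ :=
  Measure.count.real (cubeSlab R T r x (-height R x) (-height R y)) -
    Measure.count.real (cubeSlab R T r x (-height R y) (-height R x))

theorem count_cubeSlab_ne_top (hT : 0 < T) (R : Space n ≃ₗᵢ[ℝ] Space n) (hr : 0 ≤ r)
    (x : Space n) (a b : ℝ) : Measure.count (cubeSlab R T r x a b) ≠ ⊤ :=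
  ne_top_of_le_ne_top (count_slabSet_ne_top hT R hr x a b)
    (measure_mono (cubeSlab_subset_slabSet R T r x a b))

theorem hasSum_flatSpin_sub (hT : 0 < T) (hP : PeriodicSet T L) (R : Space n ≃ₗᵢ[ℝ] Space n)
    (hr : 0 ≤ r) (i j : L) :
    HasSum ({z : LatticeIndex n | (i : Space n) + shift T z ∈ R '' cube n r}.indicator
      fun z => flatSpin R (translate hP i z) - flatSpin R (translate hP j z))
      (cubeFlux R T r i j) := by
  classical
  have hslab := fun a b => hasSum_indicator_one (count_cubeSlab_ne_top hT R hr (i : Space n) a b)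
  refine ((hslab (-height R i) (-height R j)).sub
    (hslab (-height R j) (-height R i))).congr_fun fun z => ?_
  simp only [Set.indicator_apply, cubeSlab, Set.mem_ofPred_eq, levelSpin, coe_translate, map_add,
    ← not_le, neg_le_iff_add_nonneg']
  by_cases hz : (i : Space n) + shift T z ∈ R '' cube n r <;>
    by_cases hi : 0 ≤ height R i + height R (shift T z) <;>
    by_cases hj : 0 ≤ height R j + height R (shift T z) <;> simp [hz, hi, hj]

/-- The difference between the asymptotic value of `cubeFlux` and `cubeFlux` itself. -/
def fluxDefect (R : Space n ≃ₗᵢ[ℝ] Space n) (T : ℕ) (G : ℝ → ℝ) (r : ℝ) (x y : Space n) : ℝ :=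
  r ^ n * (G (-height R y) - G (-height R x)) - cubeFlux R T r x y

theorem IsLimitDistribution.hasSurfaceDensity_fluxDefect (hG : IsLimitDistribution R T G)
    (x y : Space n) :
    HasSurfaceDensity n (fun r => ENNReal.ofReal |fluxDefect R T G r x y|) 0 := by
  rw [← ENNReal.ofReal_zero]
  refine hasSurfaceDensity_ofReal ?_
  have hlim := ((hG x (-height R x) (-height R y)).const_sub
    (G (-height R y) - G (-height R x))).abs
  rw [sub_self, abs_zero] at hlim
  refine hlim.congr' ?_
  filter_upwards [eventually_cubeSlab_eq_slabSet R T x (-height R x) (-height R y),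
    eventually_cubeSlab_eq_slabSet R T x (-height R y) (-height R x),
    eventually_gt_atTop 0] with S hxy hyx hS
  have hSn : 0 < S ^ n := pow_pos hS n
  rw [fluxDefect, cubeFlux, hxy, hyx, slabDensity, ← abs_of_pos hSn, ← abs_div, abs_of_pos hSn,
    sub_div (S ^ n * _), mul_div_cancel_left₀ _ hSn.ne']

theorem exists_abs_cubeFlux_le (n : ℕ) (hT : 0 < T) :
    ∃ C : ℝ, ∀ (R : Space n ≃ₗᵢ[ℝ] Space n) (r : ℝ) (x y : Space n), 1 ≤ r →
      |cubeFlux R T r x y| ≤ C * (1 + ‖x - y‖) * r ^ n := by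
  obtain ⟨C, hC, hcount⟩ := exists_count_slabSet_le n hT
  refine ⟨C, fun R r x y hr => ?_⟩
  have : 0 ≤ r := zero_le_one.trans hr
  have hreal : ∀ a b, |b - a| ≤ ‖x - y‖ →
      Measure.count.real (cubeSlab R T r x a b) ≤ C * (1 + ‖x - y‖) * r ^ n := fun a b hab => by
    refine ENNReal.toReal_le_of_le_ofReal (by positivity) ?_
    refine (measure_mono (cubeSlab_subset_slabSet R T r x a b)).trans
      ((hcount R r a b x hr).trans (ENNReal.ofReal_le_ofReal ?_))
    gcongr
  have hheight := abs_height_le R (x - y)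
  rw [map_sub] at hheight
  refine abs_sub_le_of_nonneg_of_le measureReal_nonneg (hreal _ _ ?_) measureReal_nonneg
    (hreal _ _ ?_)
  · rwa [neg_sub_neg]
  · rwa [neg_sub_neg, abs_sub_comm]

theorem IsLimitDistribution.exists_abs_fluxDefect_le (hG : IsLimitDistribution R T G)
    (hT : 0 < T) : ∃ C : ℝ, ∀ (r : ℝ) (x y : Space n), 1 ≤ r →
      |fluxDefect R T G r x y| ≤ C * (1 + ‖x - y‖) * r ^ n := by
  obtain ⟨A, hA⟩ := hG.exists_abs_sub_le hT
  obtain ⟨C, hC⟩ := exists_abs_cubeFlux_le n hT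
  have hA0 : 0 ≤ A := (abs_nonneg _).trans (hA 0 0)
  have hT1 : (1 : ℝ) ≤ (T : ℝ) ^ (n + 1) := one_le_pow₀ (Nat.one_le_cast.2 hT)
  refine ⟨1 + A + C, fun r x y hr => ?_⟩
  have hr0 : 0 ≤ r := zero_le_one.trans hr
  have hheight := abs_height_le R (x - y)
  rw [map_sub] at hheight
  have hGxy : |G (-height R y) - G (-height R x)| ≤ (1 + A) * (1 + ‖x - y‖) := by
    have hslope : |(-height R y - -height R x) / (T : ℝ) ^ (n + 1)| ≤ ‖x - y‖ := by
      rw [neg_sub_neg, abs_div, abs_of_pos (zero_lt_one.trans_le hT1)]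
      exact (div_le_self (abs_nonneg _) hT1).trans hheight
    have htri := abs_sub_abs_le_abs_sub (G (-height R y) - G (-height R x))
      ((-height R y - -height R x) / (T : ℝ) ^ (n + 1))
    nlinarith [hA (-height R x) (-height R y), norm_nonneg (x - y)]
  calc |fluxDefect R T G r x y|
      ≤ |r ^ n * (G (-height R y) - G (-height R x))| + |cubeFlux R T r x y| := abs_sub _ _
    _ ≤ r ^ n * ((1 + A) * (1 + ‖x - y‖)) + C * (1 + ‖x - y‖) * r ^ n := by
        rw [abs_mul, abs_of_nonneg (pow_nonneg hr0 n)]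
        gcongr
        exact hC R r x y hr
    _ = (1 + A + C) * (1 + ‖x - y‖) * r ^ n := by ring

end

/-! ### The lower bound -/

section

variable {n T : ℕ} {L : Set (Space n)} {c : L → L → ℝ≥0} {R : Space n ≃ₗᵢ[ℝ] Space n}
  {hP : PeriodicSet T L} {G : ℝ → ℝ} {u : L → ℝ} {s r S δ θ : ℝ} {ν : Space n}

/-- The superposition of all lattice translates of `u - flatSpin R`, corrected by a function of the
height: for `R e_d = ν` a competitor for the periodic cell problem in a direction parallel to
`ν`. -/
def periodicCompetitor (hP : PeriodicSet T L) (R : Space n ≃ₗᵢ[ℝ] Space n) (G : ℝ → ℝ) (r : ℝ)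
    (u : L → ℝ) (x : L) : ℝ :=
  ∑' z : LatticeIndex n, (u (translate hP x z) - flatSpin R (translate hP x z)) -
    r ^ n * G (-height R x)

theorem periodicFun_periodicCompetitor (hT : 0 < T) (hP : PeriodicSet T L)
    (hR : R (lastBasisVector n) = ν) (hG : IsLimitDistribution R T G) (r : ℝ) (u : L → ℝ) :
    PeriodicFun T fun x : L => periodicCompetitor hP R G r u x -
      inner ℝ ((r ^ n / (T : ℝ) ^ (n + 1)) • ν) (x : Space n) := by
  intro z x y hxy
  obtain rfl : y = translate hP x z := Subtype.ext hxy
  have hsum : ∑' w : LatticeIndex n, (u (translate hP (translate hP x z) w) -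
      flatSpin R (translate hP (translate hP x z) w)) =
      ∑' w : LatticeIndex n, (u (translate hP x w) - flatSpin R (translate hP x w)) := by
    simp_rw [translate_translate]
    exact (Equiv.addLeft z).tsum_eq fun w => u (translate hP x w) - flatSpin R (translate hP x w)
  have hheight := hG.add_height hT (-height R x) (-z)
  rw [shift_neg, map_neg] at hheight
  simp only [periodicCompetitor, hsum, real_inner_smul_left, inner_eq_height hR, coe_translate,
    map_add, neg_add, hheight]
  ring

theorem summable_sub_flatSpin (hT : 0 < T) (hs : 1 ≤ s)
    (hu : ∀ x : L, (x : Space n) ∉ R '' cube n s → u x = flatSpin R x) (x : L) :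
    Summable fun z : LatticeIndex n => u (translate hP x z) - flatSpin R (translate hP x z) := by
  obtain ⟨C, -, hC⟩ := exists_count_image_cube_le n hT
  have hfin := Measure.count_apply_lt_top.1 ((hC R s x hs).trans_lt ENNReal.ofReal_lt_top)
  refine summable_of_hasFiniteSupport (hfin.subset fun z hz => ?_)
  by_contra h
  exact hz (sub_eq_zero.2 (hu (translate hP x z) h))

theorem sub_flatSpin_sub_le (hsr : s ≤ r) (hu1 : ∀ x, |u x - flatSpin R x| ≤ 1)
    (hu : ∀ x : L, (x : Space n) ∉ R '' cube n s → u x = flatSpin R x) (i j : L)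
    (z : LatticeIndex n) :
    u (translate hP i z) - flatSpin R (translate hP i z) -
        (u (translate hP j z) - flatSpin R (translate hP j z)) ≤
      ({z : LatticeIndex n | (i : Space n) + shift T z ∈ R '' cube n r}.indicator
          (fun z => ENNReal.ofReal (u (translate hP i z) - u (translate hP j z))) z).toReal +
        (farSet R T s r i j).indicator (fun _ => 1) z -
        {z : LatticeIndex n | (i : Space n) + shift T z ∈ R '' cube n r}.indicator
          (fun z => flatSpin R (translate hP i z) - flatSpin R (translate hP j z)) z := by
  have hfar : 0 ≤ (farSet R T s r i j).indicator (fun _ => (1 : ℝ)) z :=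
    Set.indicator_nonneg (fun _ _ => zero_le_one) z
  by_cases hi : z ∈ {z : LatticeIndex n | (i : Space n) + shift T z ∈ R '' cube n r}
  · rw [Set.indicator_of_mem hi, Set.indicator_of_mem hi,
      ENNReal.toReal_ofReal']
    linarith [le_max_left (u (translate hP i z) - u (translate hP j z)) 0]
  · rw [Set.indicator_of_notMem hi, Set.indicator_of_notMem hi,
      hu (translate hP i z) fun h => hi (image_cube_mono R hsr h), ENNReal.toReal_zero]
    by_cases hj : (j : Space n) + shift T z ∈ R '' cube n s
    · rw [Set.indicator_of_mem (show z ∈ farSet R T s r i j from ⟨hi, hj⟩)]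
      linarith [(abs_le.1 (hu1 (translate hP j z))).1]
    · rw [hu (translate hP j z) hj]
      linarith

theorem ofReal_periodicCompetitor_sub_le (hT : 0 < T) (hP : PeriodicSet T L)
    (G : ℝ → ℝ) (hs : 1 ≤ s) (hsr : s ≤ r) (hu1 : ∀ x, |u x - flatSpin R x| ≤ 1)
    (hu : ∀ x : L, (x : Space n) ∉ R '' cube n s → u x = flatSpin R x) (i j : L) :
    ENNReal.ofReal (periodicCompetitor hP R G r u i - periodicCompetitor hP R G r u j) ≤
      pairEnergy hP u (R '' cube n r) i j + Measure.count (farSet R T s r i j) +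
        ENNReal.ofReal |fluxDefect R T G r i j| := by
  by_cases htop : pairEnergy hP u (R '' cube n r) i j = ⊤
  · simp [htop]
  obtain ⟨C, -, hC⟩ := exists_count_image_cube_le n hT
  have hfar : Measure.count (farSet R T s r (i : Space n) j) ≠ ⊤ :=
    ne_top_of_le_ne_top ENNReal.ofReal_ne_top
      ((measure_mono fun z hz => hz.2).trans (hC R s j hs))
  have hsum := hasSum_le (sub_flatSpin_sub_le hsr hu1 hu i j)
    ((summable_sub_flatSpin (hP := hP) hT hs hu i).hasSum.sub
      (summable_sub_flatSpin (hP := hP) hT hs hu j).hasSum)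
    (((ENNReal.hasSum_toReal htop).add (hasSum_indicator_one hfar)).sub
      (hasSum_flatSpin_sub hT hP R (zero_le_one.trans (hs.trans hsr)) i j))
  rw [← ENNReal.tsum_toReal_eq (ENNReal.ne_top_of_tsum_ne_top htop)] at hsum
  have hreal : periodicCompetitor hP R G r u i - periodicCompetitor hP R G r u j ≤
      (pairEnergy hP u (R '' cube n r) i j).toReal + Measure.count.real (farSet R T s r i j) +
        |fluxDefect R T G r i j| := by
    have hdefect := le_abs_self (fluxDefect R T G r i j)
    simp only [periodicCompetitor, fluxDefect, pairEnergy] at hdefect hsum ⊢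
    linarith
  refine (ENNReal.ofReal_le_ofReal hreal).trans (ENNReal.ofReal_add_le.trans ?_)
  gcongr
  refine ENNReal.ofReal_add_le.trans ?_
  rw [ENNReal.ofReal_toReal htop, ofReal_measureReal hfar]

theorem pairEnergy_flatSpin_diff_le (hP : PeriodicSet T L) (hsr : s ≤ r)
    (hu1 : ∀ x, |u x - flatSpin R x| ≤ 1)
    (hu : ∀ x : L, (x : Space n) ∉ R '' cube n s → u x = flatSpin R x) (S : ℝ) (i j : L) :
    pairEnergy hP (flatSpin R) (R '' cube n S \ R '' cube n r) i j ≤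
      pairEnergy hP u (R '' cube n S \ R '' cube n r) i j +
        Measure.count (farSet R T s r i j) := by
  classical
  rw [← tsum_indicator_one, pairEnergy, pairEnergy, ← ENNReal.tsum_add]
  refine ENNReal.tsum_le_tsum fun z => ?_
  simp only [Set.indicator_apply, Set.mem_ofPred_eq, Set.mem_sdiff]
  split_ifs with hi hfar
  · rw [hu (translate hP i z) fun h => hi.2 (image_cube_mono R hsr h)]
    exact ofReal_sub_le_add_one (abs_sub_comm (u _) _ ▸ hu1 _)
  · rw [hu (translate hP i z) fun h => hi.2 (image_cube_mono R hsr h),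
      hu (translate hP j z) fun h => hfar ⟨hi.2, h⟩, add_zero]
  · exact zero_le
  · exact zero_le

/-- The error terms in the comparison of a Dirichlet competitor, flat outside `R Q_s`, with its
periodic superposition. -/
def superpositionError (R : Space n ≃ₗᵢ[ℝ] Space n) (T : ℕ) (G : ℝ → ℝ) (s r : ℝ)
    (x y : Space n) : ℝ≥0∞ :=
  2 * Measure.count (farSet R T s r x y) + ENNReal.ofReal |fluxDefect R T G r x y|

theorem periodicCell_add_energy_diff_le (hT : 0 < T) (hP : PeriodicSet T L)
    (hc : PeriodicCoeff T c) (hR : R (lastBasisVector n) = ν) (hG : IsLimitDistribution R T G)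
    (hs : 1 ≤ s) (hsr : s ≤ r) (hrS : r ≤ S) (hu1 : ∀ x, |u x - flatSpin R x| ≤ 1)
    (hu : ∀ x : L, (x : Space n) ∉ R '' cube n s → u x = flatSpin R x) :
    periodicCell T c ((r ^ n / (T : ℝ) ^ (n + 1)) • ν) +
        energy c (flatSpin R) (R '' cube n S \ R '' cube n r) ≤
      energy c u (R '' cube n S) + cellSum T c fun i j => superpositionError R T G s r i j := by
  refine (add_le_add_left (periodicCell_le_energy c
    (periodicFun_periodicCompetitor hT hP hR hG r u)) _).trans ?_
  rw [energy_cube_eq_cellSum, ← energy_image_cube_add_energy_diff c u R hrS]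
  simp only [energy_eq_cellSum hT hP hc, ← cellSum_add]
  refine cellSum_mono fun i j => ?_
  refine (add_le_add (ofReal_periodicCompetitor_sub_le hT hP G hs hsr hu1 hu i j)
    (pairEnergy_flatSpin_diff_le hP hsr hu1 hu S i j)).trans_eq ?_
  rw [superpositionError]
  ring

theorem periodicCell_add_energy_diff_le_dirichletCell (hT : 0 < T) (hP : PeriodicSet T L)
    (hc : PeriodicCoeff T c) (hR : R (lastBasisVector n) = ν) (hG : IsLimitDistribution R T G)
    (hs : 1 ≤ (1 - δ) * S) (hsr : (1 - δ) * S ≤ r) (hrS : r ≤ S) :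
    periodicCell T c ((r ^ n / (T : ℝ) ^ (n + 1)) • ν) +
        energy c (flatSpin R) (R '' cube n S \ R '' cube n r) ≤
      dirichletCell c R ν δ S +
        cellSum T c fun i j => superpositionError R T G ((1 - δ) * S) r i j := by
  simp only [dirichletCell, ENNReal.iInf_add]
  refine le_iInf₂ fun u hu => ?_
  refine periodicCell_add_energy_diff_le hT hP hc hR hG hs hsr hrS (fun x => ?_) fun x hx => ?_
  · rcases hu.1 x with h | h <;>
      rcases levelSpin_eq_zero_or_one (fun x : L => height R x) 0 x with h' | h' <;> simp [h, h']
  · rw [hu.2 x hx, halfSpaceSpin_eq_flatSpin hR]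

theorem hasSurfaceDensity_cellSum_superpositionError (hT : 0 < T) (hL : UniformlyDiscrete L)
    (hd : DecayCoeff c) (hG : IsLimitDistribution R T G) {κ : ℝ} (hκ : 0 < κ) (hκθ : κ < θ)
    (hθ : θ ≤ 1) :
    HasSurfaceDensity n (fun S => cellSum T c fun i j =>
      superpositionError R T G (κ * S) (θ * S) i j) 0 := by
  obtain ⟨A, hA⟩ := exists_count_farSet_le hT R hκ (hκθ.le.trans hθ) hκθ
  obtain ⟨B, hB⟩ := hG.exists_abs_fluxDefect_le hT
  have hfar : HasSurfaceDensity n (fun S => cellSum T c fun i j =>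
      Measure.count (farSet R T (κ * S) (θ * S) (i : Space n) j)) 0 := by
    refine hasSurfaceDensity_cellSum_zero hL hd (C := A) ?_ fun i j =>
      hasSurfaceDensity_count_farSet R T hκθ i j
    filter_upwards [eventually_ge_atTop κ⁻¹] with S hS i j using hA S i j hS
  have hdefect : HasSurfaceDensity n (fun r => cellSum T c fun i j =>
      ENNReal.ofReal |fluxDefect R T G r i j|) 0 := by
    refine hasSurfaceDensity_cellSum_zero hL hd (C := B) ?_ fun i j =>
      hG.hasSurfaceDensity_fluxDefect i j
    filter_upwards [eventually_ge_atTop 1] with r hr i j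
    exact ENNReal.ofReal_le_ofReal (hB r i j hr)
  have hsum := (hfar.add hfar).add (hdefect.comp_mul_left (hκ.trans hκθ))
  rw [add_zero, mul_zero, add_zero] at hsum
  simpa only [superpositionError, two_mul, cellSum_add] using hsum

theorem hasSurfaceDensity_periodicCell (hT : 0 < T) (hL : UniformlyDiscrete L)
    (hd : DecayCoeff c) (ν : Space n) (hθ : 0 < θ) :
    HasSurfaceDensity n
      (fun S => periodicCell T c (((θ * S) ^ n / (T : ℝ) ^ (n + 1)) • ν))
      (ENNReal.ofReal (θ ^ n) * cellDensity T c ν) := by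
  have hTn : (0 : ℝ) < (T : ℝ) ^ (n + 1) := pow_pos (Nat.cast_pos.2 hT) _
  refine HasSurfaceDensity.comp_mul_left
    (f := fun S => periodicCell T c ((S ^ n / (T : ℝ) ^ (n + 1)) • ν)) ?_ hθ
  refine tendsto_const_nhds.congr' ?_
  filter_upwards [eventually_gt_atTop 0] with S hS
  have hSn : 0 < S ^ n := pow_pos hS n
  rw [periodicCell_smul T c ν (div_pos hSn hTn), ENNReal.ofReal_div_of_pos hTn,
    ENNReal.ofReal_pow (Nat.cast_nonneg T), ENNReal.ofReal_natCast, coe_cellDensity hT hL hd,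
    div_eq_mul_inv, div_eq_mul_inv, div_eq_mul_inv, mul_right_comm, mul_right_comm _ _⁻¹ _⁻¹,
    ENNReal.mul_inv_cancel (ENNReal.ofReal_pos.2 hSn).ne' ENNReal.ofReal_ne_top, one_mul, mul_comm]

theorem le_liminf_dirichletCell (hT : 0 < T) (hL : UniformlyDiscrete L) (hP : PeriodicSet T L)
    (hc : PeriodicCoeff T c) (hd : DecayCoeff c) (hR : R (lastBasisVector n) = ν)
    (hG : IsLimitDistribution R T G) (hδ : δ < 1) (hθ : 1 - δ < θ) (hθ1 : θ ≤ 1) :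
    ENNReal.ofReal (θ ^ n) * cellDensity T c ν +
        ENNReal.ofReal (1 - θ ^ n) * levelDensity T c G (fun x : L => height R x) 0 ≤
      liminf (fun S => dirichletCell c R ν δ S / ENNReal.ofReal (S ^ n)) atTop := by
  have hκ : 0 < 1 - δ := sub_pos.2 hδ
  have hθ0 : 0 < θ := hκ.trans hθ
  have hcell := hasSurfaceDensity_periodicCell hT hL hd ν hθ0
  have hannulus := hasSurfaceDensity_energy_levelSpin_diff hT hL hc hd hG
    (isEquivariant_height hP R) 0 hθ0 hθ1
  have herror := hasSurfaceDensity_cellSum_superpositionError hT hL hd hG hκ hθ hθ1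
  have hlower := ENNReal.Tendsto.sub (hcell.add hannulus) herror (Or.inr ENNReal.zero_ne_top)
  rw [tsub_zero] at hlower
  rw [← hlower.liminf_eq]
  refine liminf_le_liminf ?_
  filter_upwards [eventually_ge_atTop (1 - δ)⁻¹] with S hS
  have hS0 : 0 ≤ S := (inv_pos.2 hκ).le.trans hS
  rw [tsub_le_iff_right, ← ENNReal.add_div]
  exact ENNReal.div_le_div_right (periodicCell_add_energy_diff_le_dirichletCell hT hP hc hR hG
    ((inv_le_iff_one_le_mul₀' hκ).1 hS) (mul_le_mul_of_nonneg_right hθ.le hS0)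
    (mul_le_of_le_one_left hS0 hθ1)) _

end

/-! ### The homogenized density -/

section

variable {n T : ℕ} {L : Set (Space n)} {c : L → L → ℝ≥0} {R : Space n ≃ₗᵢ[ℝ] Space n}
  {G : ℝ → ℝ} {u : L → ℝ} {δ : ℝ} {ν : Space n}

theorem isEquivariant_of_periodicFun (hP : PeriodicSet T L) (hR : R (lastBasisVector n) = ν)
    (hu : PeriodicFun T fun x : L => u x - inner ℝ ν (x : Space n)) : IsEquivariant hP R u := by
  intro x z
  have hxz := hu z x (translate hP x z) rfl
  simp only [inner_eq_height hR, coe_translate, map_add] at hxz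
  linarith

theorem tendsto_pow_mul_add_one_sub_pow_mul (n : ℕ) {a b : ℝ≥0∞} (ha : a ≠ ⊤) (hb : b ≠ ⊤)
    {l : Filter ℝ} {κ : ℝ} (hl : l ≤ 𝓝 κ) :
    Tendsto (fun θ => ENNReal.ofReal (θ ^ n) * a + ENNReal.ofReal (1 - θ ^ n) * b) l
      (𝓝 (ENNReal.ofReal (κ ^ n) * a + ENNReal.ofReal (1 - κ ^ n) * b)) := by
  have hpow : Tendsto (fun θ : ℝ => θ ^ n) l (𝓝 (κ ^ n)) := (tendsto_id'.2 hl).pow n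
  exact (ENNReal.Tendsto.mul_const (ENNReal.tendsto_ofReal hpow) (Or.inr ha)).add
    (ENNReal.Tendsto.mul_const (ENNReal.tendsto_ofReal (hpow.const_sub 1)) (Or.inr hb))

theorem limsup_dirichletCell_le_cellDensity (hT : 0 < T) (hL : UniformlyDiscrete L)
    (hP : PeriodicSet T L) (hc : PeriodicCoeff T c) (hd : DecayCoeff c)
    (hR : R (lastBasisVector n) = ν) (hG : IsLimitDistribution R T G) (hδ : δ ∈ Set.Ioo (0 : ℝ) 1) :
    limsup (fun S => dirichletCell c R ν δ S / ENNReal.ofReal (S ^ n)) atTop ≤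
      ENNReal.ofReal ((1 - δ) ^ n) * cellDensity T c ν +
        ENNReal.ofReal (1 - (1 - δ) ^ n) *
          levelDensity T c G (fun x : L => height R x) 0 := by
  have hθ : ENNReal.ofReal ((1 - δ) ^ n) ≠ 0 :=
    (ENNReal.ofReal_pos.2 (pow_pos (sub_pos.2 hδ.2) n)).ne'
  have hTn : ((T : ℝ≥0∞) ^ (n + 1))⁻¹ ≠ 0 :=
    ENNReal.inv_ne_zero.2 (ENNReal.pow_ne_top (ENNReal.natCast_ne_top T))
  have hTn' : ((T : ℝ≥0∞) ^ (n + 1))⁻¹ ≠ ⊤ :=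
    ENNReal.inv_ne_top.2 (pow_ne_zero _ (Nat.cast_ne_zero.2 hT.ne'))
  rw [coe_cellDensity hT hL hd, periodicCell, ENNReal.div_eq_inv_mul]
  simp only [ENNReal.mul_iInf_of_ne hTn hTn', ENNReal.mul_iInf_of_ne hθ ENNReal.ofReal_ne_top,
    ENNReal.iInf_add]
  refine le_iInf₂ fun v hv => ?_
  obtain ⟨t, ht⟩ := hG.exists_levelDensity_le hT hL hP c v
  rw [← ENNReal.div_eq_inv_mul]
  refine (limsup_dirichletCell_le hT hL hc hd hR hG
    (isEquivariant_of_periodicFun hP hR hv) t hδ).trans ?_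
  gcongr

theorem tendsto_dirichletCell (hT : 0 < T) (hL : UniformlyDiscrete L) (hP : PeriodicSet T L)
    (hc : PeriodicCoeff T c) (hd : DecayCoeff c) (hR : R (lastBasisVector n) = ν)
    (hG : IsLimitDistribution R T G) (hδ : δ ∈ Set.Ioo (0 : ℝ) 1) :
    Tendsto (fun S => dirichletCell c R ν δ S / ENNReal.ofReal (S ^ n)) atTop
      (𝓝 (ENNReal.ofReal ((1 - δ) ^ n) * cellDensity T c ν +
        ENNReal.ofReal (1 - (1 - δ) ^ n) *
          levelDensity T c G (fun x : L => height R x) 0)) := by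
  refine tendsto_of_le_liminf_of_limsup_le ?_
    (limsup_dirichletCell_le_cellDensity hT hL hP hc hd hR hG hδ)
  have hflat := levelDensity_ne_top hT hL hd hG (isEquivariant_height hP R) 0
  refine le_of_tendsto (tendsto_pow_mul_add_one_sub_pow_mul n ENNReal.coe_ne_top hflat
    (nhdsWithin_le_nhds (s := Set.Ioi (1 - δ)))) ?_
  filter_upwards [Ioo_mem_nhdsGT (sub_lt_self 1 hδ.1)] with θ hθ
  exact le_liminf_dirichletCell hT hL hP hc hd hR hG hδ.2 hθ.1 hθ.2.le

theorem isHomogenizedDensity_cellDensity (hT : 0 < T) (hL : UniformlyDiscrete L)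
    (hP : PeriodicSet T L) (hc : PeriodicCoeff T c) (hd : DecayCoeff c)
    {R : Space n → (Space n ≃ₗᵢ[ℝ] Space n)} (hR : IsFrameChoice R) :
    IsHomogenizedDensity c R (cellDensity T c) where
  convex := convexOn_cellDensity hT hL hd
  homogeneous _ ν ht := cellDensity_smul hT hL hd ht ν
  cell_limit ν hν := by
    obtain ⟨G, hG⟩ := exists_isLimitDistribution hT (R ν)
    refine ⟨_, fun δ hδ => tendsto_dirichletCell hT hL hP hc hd (hR ν hν) hG hδ, ?_⟩
    have hflat := levelDensity_ne_top hT hL hd hG (isEquivariant_height hP (R ν)) 0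
    have hone : Tendsto (fun δ : ℝ => 1 - δ) (𝓝[>] 0) (𝓝 1) := by
      simpa using (tendsto_nhdsWithin_of_tendsto_nhds
        (tendsto_id.const_sub (1 : ℝ)) : Tendsto (fun δ : ℝ => 1 - δ) (𝓝[>] 0) (𝓝 (1 - 0)))
    simpa [Function.comp_def] using
      (tendsto_pow_mul_add_one_sub_pow_mul n (ENNReal.coe_ne_top (r := cellDensity T c ν)) hflat
        le_rfl).comp hone

end

end SpinHomogenization

end

theorem proposition2p6 (n T : ℕ) (hT : 0 < T)
    (L : Set (SpinHomogenization.Space n))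
    (hL1 : SpinHomogenization.UniformlyDiscrete L)
    (hL2 : SpinHomogenization.PeriodicSet T L)
    (R : SpinHomogenization.Space n →
      (SpinHomogenization.Space n ≃ₗᵢ[ℝ] SpinHomogenization.Space n))
    (hR : SpinHomogenization.IsFrameChoice R)
    (c : L → L → ℝ≥0)
    (hH1 : SpinHomogenization.PeriodicCoeff T c)
    (hH2 : SpinHomogenization.DecayCoeff c) :
    (∃! φ : SpinHomogenization.Space n → ℝ≥0, SpinHomogenization.IsHomogenizedDensity c R φ) ∧
    ∀ φ : SpinHomogenization.Space n → ℝ≥0, SpinHomogenization.IsHomogenizedDensity c R φ →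
      ∀ ν : SpinHomogenization.Space n,
        (φ ν : ℝ≥0∞) = SpinHomogenization.periodicCell T c ν / (T : ℝ≥0∞) ^ (n + 1) := by
  have h := SpinHomogenization.isHomogenizedDensity_cellDensity hT hL1 hL2 hH1 hH2 hR
  refine ⟨⟨_, h, fun ψ hψ => hψ.eq h⟩, fun φ hφ ν => ?_⟩
  rw [hφ.eq h, SpinHomogenization.coe_cellDensity hT hL1 hH2]
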